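/- Let $G=(V,E)$, $V=\{1,\dots,p\}$, be a directed acyclic graph and let $\breve{\mathbf x}(k)\in\mathbb R^p$, $k\in\mathbb Z$, be the state of the linear dynamical system $$\breve x_i(k)=\sum_{(j,i)\in E}(\breve h_{ij}\star\breve x_j)(k)+\breve e_i(k),\qquad 1\le i\le p,\ k\in\mathbb Z,$$ with nonzero absolutely summable real filters $\breve h_{ij}$ (for $(j,i)\in E$), where $\breve{\mathbf e}$ is a zero mean, wide-sense stationary, jointly Gaussian process, uncorrelated across nodes, with summable auto-correlation and power spectral density matrix $\Phi_{\mathbf e}(\omega)=\sigma(\omega)\mathbf I$. Let $R_{\mathbf x}(k)=\mathbb E[\breve{\mathbf x}(k)\breve{\mathbf x}(0)^T]$ and $\Phi_{\mathbf x}(\omega)=\sum_{k\in\mathbb Z}R_{\mathbf x}(k)e^{-i\omega k}$, and suppose that for some $M>0$ $$\tfrac1M\le\lambda_{\min}(\Phi_{\mathbf x}(\omega))\le\lambda_{\max}(\Phi_{\mathbf x}(\omega))\le M\qquad\text{for all }\omega\in[0,2\pi].$$ Let $n,N\ge1$ and let $\{\breve{\mathbf x}^r(k)\}_{k=0}^{N-1}$,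 $1\le r\le n$, be trajectories obtained in one of the following two ways: (i) restart and record: the $n$ trajectories are independent, each distributed as $(\breve{\mathbf x}(0),\dots,\breve{\mathbf x}(N-1))$; (ii) continuous sampling: $\breve{\mathbf x}^r(k)=\breve{\mathbf x}((r-1)N+k)$, i.e. consecutive segments of a single trajectory. Put $$\mathbf x^r(\omega)=\frac1{\sqrt N}\sum_{k=0}^{N-1}\breve{\mathbf x}^r(k)e^{-i\omega k},\qquad \widehat\Phi_{\mathbf x}(\omega)=\frac1n\sum_{r=1}^n\mathbf x^r(\omega)\mathbf x^r(\omega)^*,\qquad \widetilde\Phi_{\mathbf x}(\omega)=\mathbb E\left[\mathbf x^r(\omega)\mathbf x^r(\omega)^*\right]$$ (the last matrix does not depend on $r$). Then, in both cases, for every $\omega\in[0,2\pi]$ and every $0\le\epsilon\le 12M$, $$\mathbb P\left(\left\|\widehat\Phi_{\mathbf x}(\omega)-\widetilde\Phi_{\mathbf x}(\omega)\right\|\ge\epsilon\right)\le\exp\left(-\frac{\epsilon^2n}{128M^2}+6p\right),$$ where $\|\cdot\|$ is the spectral norm. -/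

import Mathlib

open MeasureTheory ProbabilityTheory
open scoped Matrix.Norms.L2Operator

noncomputable section

namespace DDAG

/-- A directed graph is acyclic if no vertex can be reached from itself along directed edges. -/
def IsAcyclic {V : Type*} (G : Digraph V) : Prop :=
  ∀ i, ¬ Relation.TransGen G.Adj i i

section Model

variable {Ω : Type*} [MeasurableSpace Ω] {p : ℕ}

/-- The entry `(i, j)` of the auto-correlation matrix `R_z(k) = E[z(k) z(0)ᵀ]` of a vector
process `z`, where `z i k` is the `i`-th coordinate at time `k`. -/
def autocorr (μ : Measure Ω) (z : Fin p → ℤ → Ω → ℝ) (k : ℤ) : Matrix (Fin p) (Fin p) ℝ :=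
  Matrix.of fun i j => ∫ w, z i k w * z j 0 w ∂μ

/-- The power spectral density matrix `Φ_z(θ) = ∑ₖ R_z(k) e^{-iθk}`. -/
def psd (μ : Measure Ω) (z : Fin p → ℤ → Ω → ℝ) (θ : ℝ) : Matrix (Fin p) (Fin p) ℂ :=
  Matrix.of fun i j =>
    ∑' k : ℤ, (autocorr μ z k i j : ℂ) * Complex.exp (-(Complex.I * θ * k))

/-- The exogenous noise: a zero mean, wide-sense stationary, (jointly) Gaussian vector process,
uncorrelated across nodes, whose auto-correlation is summable (so that its power spectral density
is defined) with `Φ_e(θ) = σ(θ) I` on `[0, 2π]`. -/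
structure IsNoise (μ : Measure Ω) (e : Fin p → ℤ → Ω → ℝ) (σ : ℝ → ℝ) : Prop where
  gaussian : IsGaussianProcess (fun t : Fin p × ℤ => e t.1 t.2) μ
  mean_zero : ∀ i k, ∫ w, e i k w ∂μ = 0
  stationary : ∀ i (k m : ℤ), ∫ w, e i (k + m) w * e i m w ∂μ = ∫ w, e i k w * e i 0 w ∂μ
  uncorrelated : ∀ i j, i ≠ j → ∀ k m : ℤ, ∫ w, e i k w * e j m w ∂μ = 0
  summable : ∀ i, Summable fun k : ℤ => autocorr μ e k i i
  equal_psd : ∀ θ ∈ Set.Icc 0 (2 * Real.pi), psd μ e θ = (σ θ : ℂ) • 1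

open Classical in
/-- The process `x` is the state of the linear dynamical system on the directed acyclic graph `G`
with (possibly two-sided) filters `h i j` attached to the edges `j → i` and noise `e`:
`x_i(k) = ∑_{j → i} (h_ij ⋆ x_j)(k) + e_i(k)` almost surely, for all nodes `i` and times `k`. -/
structure IsLDS (μ : Measure Ω) (G : Digraph (Fin p)) (h : Fin p → Fin p → ℤ → ℝ)
    (σ : ℝ → ℝ) (e x : Fin p → ℤ → Ω → ℝ) : Prop where
  acyclic : IsAcyclic G
  filter_ne_zero : ∀ i j, G.Adj j i → h i j ≠ 0
  filter_summable : ∀ i j, G.Adj j i → Summable (h i j)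
  noise : IsNoise μ e σ
  measurable : ∀ i k, Measurable (x i k)
  conv_summable : ∀ i j, G.Adj j i → ∀ k : ℤ,
    ∀ᵐ w ∂μ, Summable fun l : ℤ => h i j l * x j (k - l) w
  evolution : ∀ i (k : ℤ), ∀ᵐ w ∂μ,
    x i k w = (∑ j with G.Adj j i, ∑' l : ℤ, h i j l * x j (k - l) w) + e i k w

/-- For every frequency in `[0, 2π]`, the eigenvalues of the (Hermitian) power spectral density
matrix of `x` lie in `[1/M, M]`. -/
def PSDBounded (μ : Measure Ω) (x : Fin p → ℤ → Ω → ℝ) (M : ℝ) : Prop :=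
  0 < M ∧ ∀ θ ∈ Set.Icc 0 (2 * Real.pi), ∃ hΦ : (psd μ x θ).IsHermitian,
    ∀ i, 1 / M ≤ hΦ.eigenvalues i ∧ hΦ.eigenvalues i ≤ M

/-- The `N` consecutive samples `x(t), …, x(t + N - 1)` as one random variable. -/
def window (x : Fin p → ℤ → Ω → ℝ) (N : ℕ) (t : ℤ) (w : Ω) : Fin N → Fin p → ℝ :=
  fun k i => x i (t + (k : ℕ)) w

/-- Restart and record: the `n` recorded trajectories (on a probability space of their own) are
independent, and each is distributed as `N` consecutive samples of the system state `x`. -/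
def IsRestartRecord {Ω' : Type*} [MeasurableSpace Ω'] {n N : ℕ} (μ : Measure Ω)
    (x : Fin p → ℤ → Ω → ℝ) (P : Measure Ω') (y : Fin n → Ω' → Fin N → Fin p → ℝ) : Prop :=
  iIndepFun y P ∧ ∀ r, IdentDistrib (y r) (window x N 0) P μ

/-- Continuous sampling: a single trajectory `x(0), …, x(nN - 1)` is cut into `n` consecutive
segments of `N` samples. -/
def segments (n N : ℕ) (x : Fin p → ℤ → Ω → ℝ) (r : Fin n) : Ω → Fin N → Fin p → ℝ :=
  window x N (((r : ℕ) * N : ℕ) : ℤ)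

end Model

section Spectrogram

variable {Ω : Type*} [MeasurableSpace Ω] {p n N : ℕ}

/-- The normalised Fourier transform `N^{-1/2} ∑_{k < N} y(k) e^{-iθk}` of a trajectory. -/
def dft (y : Fin N → Fin p → ℝ) (θ : ℝ) : Fin p → ℂ :=
  fun i => ((1 / Real.sqrt N : ℝ) : ℂ) *
    ∑ k : Fin N, (y k i : ℂ) * Complex.exp (-(Complex.I * θ * (k : ℕ)))

/-- The rank one matrix `v v*`. -/
def outer (v : Fin p → ℂ) : Matrix (Fin p) (Fin p) ℂ :=
  Matrix.vecMulVec v (star v)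

/-- The spectrogram estimator `(1/n) ∑_r x^r(θ) x^r(θ)*`, where `x^r(θ)` is the transform of the
`r`-th trajectory. -/
def spectrogram (y : Fin n → Fin N → Fin p → ℝ) (θ : ℝ) : Matrix (Fin p) (Fin p) ℂ :=
  (1 / n : ℂ) • ∑ r, outer (dft (y r) θ)

/-- The covariance matrix `E[x^r(θ) x^r(θ)*]` of the transform of a random trajectory. -/
def dftCov (P : Measure Ω) (y : Ω → Fin N → Fin p → ℝ) (θ : ℝ) : Matrix (Fin p) (Fin p) ℂ :=
  Matrix.of fun i j => ∫ w, outer (dft (y w) θ) i j ∂P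

end Spectrogram

end DDAG

end

/-!
For a unit vector `v`, the quadratic form `v* Φ̂(θ) v` is `1 / n` times the squared norm of a real
Gaussian vector of dimension `2 n`, the image of the stacked samples under a contraction. The
covariance of the samples is, in both sampling schemes, a block Toeplitz section of the symbol `Φ_x`
(or a direct sum of such sections), so it is at most `M` in the Loewner order. In its principal axes
the squared norm is therefore a sum of `2 n` squares of independent centred Gaussians of variance at
most `M`, which deviates from its mean by `n δ ≤ 6 n M` with probability at most
`2 exp (-δ² n / (32 M²))`. A net of at most `25 ^ p` unit vectors of `ℂ^p` recovers half of the
spectral norm of a Hermitian matrix, and `2 · 25 ^ p ≤ e ^ (6 p)` for `p ≥ 1`.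

By induction along the acyclic graph, the state is obtained from the noise by finitely many
additions and summable convolutions in `L²`. Hence it lies in the closed linear span of the noise,
which is a Gaussian space, and it is jointly stationary with summable correlations.
-/

noncomputable section

namespace DDAG

section Subexponential

variable {Ω : Type*} [MeasurableSpace Ω] {P : Measure Ω}

/-- A real random variable is sub-exponential with parameters `c` and `b` if its moment generating
function is at most `exp (c t ^ 2)` for `|t| ≤ b`. -/
structure HasSubexponentialMGF (X : Ω → ℝ) (c b : ℝ) (P : Measure Ω) : Prop where
  integrable_exp_mul : ∀ t, |t| ≤ b → Integrable (fun w => Real.exp (t * X w)) P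
  mgf_le : ∀ t, |t| ≤ b → mgf X P t ≤ Real.exp (c * t ^ 2)

namespace HasSubexponentialMGF

variable {X : Ω → ℝ} {b c : ℝ}

lemma neg (hX : HasSubexponentialMGF X c b P) : HasSubexponentialMGF (-X) c b P where
  integrable_exp_mul t ht := by
    simpa using hX.integrable_exp_mul (-t) (by rwa [abs_neg])
  mgf_le t ht := by
    simpa [mgf_neg] using hX.mgf_le (-t) (by rwa [abs_neg])

lemma sum_of_iIndepFun {ι : Type*} [Fintype ι] {X : ι → Ω → ℝ} (hind : iIndepFun X P)
    (hmeas : ∀ i, AEMeasurable (X i) P) (hX : ∀ i, HasSubexponentialMGF (X i) c b P) :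
    HasSubexponentialMGF (∑ i, X i) (Fintype.card ι * c) b P where
  integrable_exp_mul t ht := by
    have := hind.isProbabilityMeasure
    rw [← mgf_pos_iff, hind.mgf_sum₀ hmeas]
    exact Finset.prod_pos fun i _ => mgf_pos ((hX i).integrable_exp_mul t ht)
  mgf_le t ht :=
    calc mgf (∑ i, X i) P t = ∏ i, mgf (X i) P t := hind.mgf_sum₀ hmeas _
      _ ≤ ∏ _i : ι, Real.exp (c * t ^ 2) :=
        Finset.prod_le_prod (fun _ _ => mgf_nonneg) fun i _ => (hX i).mgf_le t ht
      _ = Real.exp (Fintype.card ι * c * t ^ 2) := by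
        rw [Finset.prod_const, ← Real.exp_nat_mul, Finset.card_univ, mul_assoc]

lemma measureReal_ge_le [IsFiniteMeasure P] (hX : HasSubexponentialMGF X c b P) (hc : 0 < c)
    {a : ℝ} (ha : 0 ≤ a) (hab : a ≤ 2 * c * b) :
    P.real {w | a ≤ X w} ≤ Real.exp (-(a ^ 2 / (4 * c))) := by
  set t := a / (2 * c) with ht
  have ht0 : 0 ≤ t := by positivity
  have htb : |t| ≤ b := by
    rw [abs_of_nonneg ht0, ht, div_le_iff₀ (by positivity)]
    linarith
  calc P.real {w | a ≤ X w} ≤ Real.exp (-t * a) * mgf X P t :=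
        measure_ge_le_exp_mul_mgf a ht0 (hX.integrable_exp_mul t htb)
    _ ≤ Real.exp (-t * a) * Real.exp (c * t ^ 2) := by gcongr; exact hX.mgf_le t htb
    _ = Real.exp (-(a ^ 2 / (4 * c))) := by
        rw [← Real.exp_add, ht]
        congr 1
        field_simp
        ring

lemma measureReal_abs_ge_le [IsFiniteMeasure P] (hX : HasSubexponentialMGF X c b P) (hc : 0 < c)
    {a : ℝ} (ha : 0 ≤ a) (hab : a ≤ 2 * c * b) :
    P.real {w | a ≤ |X w|} ≤ 2 * Real.exp (-(a ^ 2 / (4 * c))) :=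
  calc P.real {w | a ≤ |X w|} = P.real ({w | a ≤ X w} ∪ {w | a ≤ (-X) w}) := by
        congr 1
        ext w
        exact le_abs (a := a) (b := X w)
    _ ≤ P.real {w | a ≤ X w} + P.real {w | a ≤ (-X) w} := measureReal_union_le _ _
    _ ≤ 2 * Real.exp (-(a ^ 2 / (4 * c))) := by
        linarith [hX.measureReal_ge_le hc ha hab, hX.neg.measureReal_ge_le hc ha hab]

end HasSubexponentialMGF

end Subexponential

section GaussianSquare

lemma one_le_one_sub_two_mul_mul_exp {s : ℝ} (hs : s ≤ 3 / 8) :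
    1 ≤ (1 - 2 * s) * Real.exp (2 * s + 8 * s ^ 2) := by
  have hpos : 0 < 1 - 2 * s := by linarith
  rcases le_or_gt s (1 / 4) with h | h
  · calc (1 : ℝ) ≤ (1 - 2 * s) * (2 * s + 8 * s ^ 2 + 1) := by
          nlinarith [mul_nonneg (sq_nonneg s) (sub_nonneg.2 h)]
      _ ≤ _ := by gcongr; exact Real.add_one_le_exp _
  · have hcube : s ^ 3 ≤ (3 / 8) ^ 3 := by gcongr
    have h3 : 0 ≤ 3 - 2 * s - 32 * s ^ 3 := by linarith
    calc (1 : ℝ) ≤ (1 - 2 * s) * (1 + (2 * s + 8 * s ^ 2) + (2 * s + 8 * s ^ 2) ^ 2 / 2) := by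
          nlinarith [mul_nonneg (sq_nonneg s) h3]
      _ ≤ _ := by gcongr; exact Real.quadratic_le_exp_of_nonneg (by positivity)

lemma inv_sqrt_mul_exp_neg_le {s : ℝ} (hs : s ≤ 3 / 8) :
    (√(1 - 2 * s))⁻¹ * Real.exp (-s) ≤ Real.exp (4 * s ^ 2) := by
  have hpos : 0 < 1 - 2 * s := by linarith
  have hsqrt : 1 ≤ √(1 - 2 * s) * Real.exp (s + 4 * s ^ 2) := by
    rw [← Real.sqrt_sq (Real.exp_nonneg (s + 4 * s ^ 2)), ← Real.sqrt_mul hpos.le,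
      Real.one_le_sqrt, ← Real.exp_nat_mul]
    convert one_le_one_sub_two_mul_mul_exp hs using 3
    push_cast
    ring
  rw [inv_mul_le_iff₀ (Real.sqrt_pos.2 hpos), Real.exp_neg, inv_le_iff_one_le_mul₀ (by positivity),
    mul_assoc, ← Real.exp_add, add_comm]
  exact hsqrt

lemma mgf_sq_gaussianReal (v : NNReal) {t : ℝ} (ht : 2 * (v * t) < 1) :
    mgf (fun x => x ^ 2) (gaussianReal 0 v) t = (√(1 - 2 * (v * t)))⁻¹ := by
  rcases eq_or_ne v 0 with rfl | hv
  · simp [mgf, gaussianReal_zero_var]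
  have : (0 : ℝ) < v := by positivity
  have hdensity : ∀ x : ℝ, gaussianPDFReal 0 v x * Real.exp (t * x ^ 2)
      = (√(2 * Real.pi * v))⁻¹ * Real.exp (-(1 / (2 * (v : ℝ)) - t) * x ^ 2) := by
    intro x
    rw [gaussianPDFReal, mul_assoc, ← Real.exp_add]
    congr 2
    field_simp
    ring
  simp_rw [mgf, integral_gaussianReal_eq_integral_smul hv, smul_eq_mul, hdensity]
  rw [integral_const_mul, integral_gaussian, ← Real.sqrt_inv, ← Real.sqrt_inv,
    ← Real.sqrt_mul (by positivity)]
  congr 1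
  have : 1 - 2 * ((v : ℝ) * t) ≠ 0 := by linarith
  field_simp

variable {Ω : Type*} [MeasurableSpace Ω] {P : Measure Ω} {X : Ω → ℝ} {M : ℝ}

lemma mgf_sq_of_hasGaussianLaw (hX : HasGaussianLaw X P) (hmean : P[X] = 0) {t : ℝ}
    (ht : 2 * ((∫ w, X w ^ 2 ∂P) * t) < 1) :
    mgf (fun w => X w ^ 2) P t = (√(1 - 2 * ((∫ w, X w ^ 2 ∂P) * t)))⁻¹ := by
  have hvar : ((∫ w, X w ^ 2 ∂P).toNNReal : ℝ) = ∫ w, X w ^ 2 ∂P :=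
    Real.coe_toNNReal _ (integral_nonneg fun w => sq_nonneg _)
  have hlaw : P.map X = gaussianReal 0 (∫ w, X w ^ 2 ∂P).toNNReal := by
    rw [hX.map_eq_gaussianReal, hmean, variance_of_integral_eq_zero hX.aemeasurable hmean]
  have hmgf := mgf_map (X := fun x : ℝ => x ^ 2) hX.aemeasurable (t := t)
    (Continuous.aestronglyMeasurable (by fun_prop))
  rw [hlaw, mgf_sq_gaussianReal _ (by rwa [hvar]), hvar] at hmgf
  exact hmgf.symm

lemma hasSubexponentialMGF_sq_sub_integral (hX : HasGaussianLaw X P) (hmean : P[X] = 0)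
    (hM : 0 < M) (hvar : ∫ w, X w ^ 2 ∂P ≤ M) :
    HasSubexponentialMGF (fun w => X w ^ 2 - ∫ w, X w ^ 2 ∂P) (4 * M ^ 2) (3 / (8 * M)) P := by
  have := hX.isProbabilityMeasure
  set v := ∫ w, X w ^ 2 ∂P
  have hv0 : 0 ≤ v := integral_nonneg fun w => sq_nonneg _
  have hvt : ∀ t, |t| ≤ 3 / (8 * M) → v * t ≤ 3 / 8 := fun t ht => by
    rw [le_div_iff₀ (by positivity)] at ht
    nlinarith [le_abs_self t, abs_nonneg t]
  have hmgf : ∀ t, |t| ≤ 3 / (8 * M) →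
      mgf (fun w => X w ^ 2 - v) P t = (√(1 - 2 * (v * t)))⁻¹ * Real.exp (-(v * t)) :=
    fun t ht => by
      simp_rw [sub_eq_add_neg]
      rw [mgf_add_const, mgf_sq_of_hasGaussianLaw hX hmean (by linarith [hvt t ht]),
        ← sub_eq_add_neg, mul_neg, mul_comm t v]
  refine ⟨fun t ht => ?_, fun t ht => ?_⟩
  · have : 0 < 1 - 2 * (v * t) := by linarith [hvt t ht]
    rw [← mgf_pos_iff, hmgf t ht]
    positivity
  · calc mgf (fun w => X w ^ 2 - v) P t ≤ Real.exp (4 * (v * t) ^ 2) :=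
          (hmgf t ht).trans_le (inv_sqrt_mul_exp_neg_le (hvt t ht))
      _ ≤ Real.exp (4 * M ^ 2 * t ^ 2) := by
          rw [mul_pow, ← mul_assoc]
          gcongr

end GaussianSquare

section CentredGaussian

variable {Ω : Type*} [MeasurableSpace Ω] {P : Measure Ω}
  {E : Type*} [NormedAddCommGroup E] [InnerProductSpace ℝ E] [MeasurableSpace E] [BorelSpace E]
  {F : Type*} [NormedAddCommGroup F] [InnerProductSpace ℝ F] [MeasurableSpace F] [BorelSpace F]
  {Z : Ω → E} {M : ℝ}

/-- `Z` is a centred Gaussian vector whose covariance operator is at most `M • 1` in the Loewner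
order. -/
structure IsCentredGaussianLE (Z : Ω → E) (M : ℝ) (P : Measure Ω) : Prop where
  hasGaussianLaw : HasGaussianLaw Z P
  integral_eq_zero : P[Z] = 0
  variance_inner_le : ∀ u, Var[fun w => inner ℝ u (Z w); P] ≤ M * ‖u‖ ^ 2

lemma hasGaussianLaw_inner (hZ : HasGaussianLaw Z P) (u : E) :
    HasGaussianLaw (fun w => inner ℝ u (Z w)) P :=
  hZ.map_fun (innerSL ℝ u)

lemma integral_inner_eq_zero [CompleteSpace E] [SecondCountableTopology E]
    (hZ : HasGaussianLaw Z P) (hmean : P[Z] = 0) (u : E) : ∫ w, inner ℝ u (Z w) ∂P = 0 := by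
  rw [integral_inner hZ.integrable, hmean, inner_zero_right]

lemma exists_orthonormalBasis_integral_inner_mul_inner_eq_zero [FiniteDimensional ℝ E]
    {ν : Measure E} (hν : MemLp id 2 ν) :
    ∃ b : OrthonormalBasis (Fin (Module.finrank ℝ E)) ℝ E,
      ∀ i j, i ≠ j → ∫ z, inner ℝ (b i) z * inner ℝ (b j) z ∂ν = 0 := by
  have hsymm := (isPositive_covarianceOperator (μ := ν)).isSymmetric
  refine ⟨hsymm.eigenvectorBasis rfl, fun i j hij => ?_⟩
  rw [← covarianceOperator_inner hν, ← ContinuousLinearMap.coe_coe, hsymm.apply_eigenvectorBasis,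
    real_inner_smul_left, (hsymm.eigenvectorBasis rfl).orthonormal.2 hij, mul_zero]

lemma exists_orthonormalBasis_iIndepFun [FiniteDimensional ℝ E] (hZ : HasGaussianLaw Z P)
    (hmean : P[Z] = 0) :
    ∃ b : OrthonormalBasis (Fin (Module.finrank ℝ E)) ℝ E,
      iIndepFun (fun i w => inner ℝ (b i) (Z w)) P := by
  have := hZ.isProbabilityMeasure
  have := hZ.isGaussian_map
  obtain ⟨b, hb⟩ := exists_orthonormalBasis_integral_inner_mul_inner_eq_zero
    (IsGaussian.memLp_two_id (μ := P.map Z))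
  refine ⟨b, HasGaussianLaw.iIndepFun_of_covariance_eq_zero ?_ fun i j hij => ?_⟩
  · exact hZ.map_fun (ContinuousLinearMap.pi fun i => innerSL ℝ (b i))
  · rw [covariance_eq_sub (hasGaussianLaw_inner hZ _).memLp_two
      (hasGaussianLaw_inner hZ _).memLp_two, integral_inner_eq_zero hZ hmean, zero_mul, sub_zero,
      ← hb i j hij, integral_map hZ.aemeasurable (Continuous.aestronglyMeasurable (by fun_prop))]
    rfl

namespace IsCentredGaussianLE

lemma hasSubexponentialMGF_norm_sq [FiniteDimensional ℝ E] (hZ : IsCentredGaussianLE Z M P)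
    (hM : 0 < M) :
    HasSubexponentialMGF (fun w => ‖Z w‖ ^ 2 - ∫ w, ‖Z w‖ ^ 2 ∂P)
      (Module.finrank ℝ E * (4 * M ^ 2)) (3 / (8 * M)) P := by
  obtain ⟨b, hb⟩ := exists_orthonormalBasis_iIndepFun hZ.hasGaussianLaw hZ.integral_eq_zero
  set W : Fin (Module.finrank ℝ E) → Ω → ℝ := fun i w => inner ℝ (b i) (Z w)
  have hW : ∀ i, HasGaussianLaw (W i) P := fun i => hasGaussianLaw_inner hZ.hasGaussianLaw _
  have hW0 : ∀ i, ∫ w, W i w ∂P = 0 := fun i =>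
    integral_inner_eq_zero hZ.hasGaussianLaw hZ.integral_eq_zero _
  have hWvar : ∀ i, ∫ w, W i w ^ 2 ∂P ≤ M := fun i => by
    rw [← variance_of_integral_eq_zero (hW i).aemeasurable (hW0 i)]
    simpa using hZ.variance_inner_le (b i)
  have hnorm : ∀ w, ‖Z w‖ ^ 2 = ∑ i, W i w ^ 2 := fun w => by
    simpa using (b.sum_sq_norm_inner_right (Z w)).symm
  have hsum : (fun w => ‖Z w‖ ^ 2 - ∫ w, ‖Z w‖ ^ 2 ∂P)
      = ∑ i, fun w => W i w ^ 2 - ∫ w, W i w ^ 2 ∂P := by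
    ext w
    simp_rw [hnorm]
    rw [integral_finsetSum _ fun i _ => (hW i).memLp_two.integrable_sq, ← Finset.sum_sub_distrib,
      Finset.sum_apply]
  rw [hsum]
  simpa only [Fintype.card_fin] using HasSubexponentialMGF.sum_of_iIndepFun
    (X := fun i w => W i w ^ 2 - ∫ w, W i w ^ 2 ∂P)
    (hb.comp (fun i x => x ^ 2 - ∫ w, W i w ^ 2 ∂P) fun i => by fun_prop)
    (fun i => ((hW i).aemeasurable.pow_const 2).sub_const _)
    fun i => hasSubexponentialMGF_sq_sub_integral (hW i) (hW0 i) hM (hWvar i)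

lemma measureReal_abs_norm_sq_sub_ge_le [FiniteDimensional ℝ E] [Nontrivial E]
    (hZ : IsCentredGaussianLE Z M P) (hM : 0 < M) {a : ℝ} (ha : 0 ≤ a)
    (haM : a ≤ 3 * Module.finrank ℝ E * M) :
    P.real {w | a ≤ |‖Z w‖ ^ 2 - ∫ w, ‖Z w‖ ^ 2 ∂P|}
      ≤ 2 * Real.exp (-(a ^ 2 / (16 * Module.finrank ℝ E * M ^ 2))) := by
  have := hZ.hasGaussianLaw.isProbabilityMeasure
  have hd : (0 : ℝ) < Module.finrank ℝ E := by exact_mod_cast Module.finrank_pos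
  convert (hZ.hasSubexponentialMGF_norm_sq hM).measureReal_abs_ge_le (by positivity) ha ?_ using 5
  · ring
  · refine haM.trans_eq ?_
    field_simp
    ring

lemma map [FiniteDimensional ℝ E] [CompleteSpace F] (hZ : IsCentredGaussianLE Z M P) (hM : 0 ≤ M)
    {A : E →L[ℝ] F} (hA : ‖A‖ ≤ 1) : IsCentredGaussianLE (fun w => A (Z w)) M P where
  hasGaussianLaw := hZ.hasGaussianLaw.map_fun A
  integral_eq_zero := by
    rw [A.integral_comp_comm hZ.hasGaussianLaw.integrable, hZ.integral_eq_zero, map_zero]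
  variance_inner_le u := by
    have hadjoint : ‖A.adjoint u‖ ≤ ‖u‖ :=
      A.adjoint.le_of_opNorm_le ((LinearIsometryEquiv.norm_map _ A).trans_le hA) u |>.trans_eq
        (one_mul _)
    simp_rw [← A.adjoint_inner_left]
    refine (hZ.variance_inner_le _).trans ?_
    gcongr

lemma of_identDistrib {Ω' : Type*} [MeasurableSpace Ω'] {P' : Measure Ω'} {Z' : Ω' → E}
    (hZ : IsCentredGaussianLE Z M P) (hid : IdentDistrib Z' Z P' P) :
    IsCentredGaussianLE Z' M P' where
  hasGaussianLaw := ⟨hid.map_eq ▸ hZ.hasGaussianLaw.isGaussian_map⟩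
  integral_eq_zero := hid.integral_eq.trans hZ.integral_eq_zero
  variance_inner_le u :=
    (hid.comp (u := fun z => inner ℝ u z) (by fun_prop)).variance_eq.trans_le
      (hZ.variance_inner_le u)

lemma of_iIndepFun {ι : Type*} [Fintype ι] [FiniteDimensional ℝ E] {Z : ι → Ω → E}
    (hind : iIndepFun Z P) (hZ : ∀ i, IsCentredGaussianLE (Z i) M P) :
    IsCentredGaussianLE (E := PiLp 2 fun _ : ι => E) (fun w => WithLp.toLp 2 fun i => Z i w)
      M P := by
  have hlaw : HasGaussianLaw (fun w => WithLp.toLp 2 fun i => Z i w) P :=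
    (iIndepFun.hasGaussianLaw (fun i => (hZ i).hasGaussianLaw) hind).toLp_pi 2
  refine ⟨hlaw, ?_, fun u => ?_⟩
  · ext i
    exact ((PiLp.proj 2 (𝕜 := ℝ) (fun _ : ι => E) i).integral_comp_comm hlaw.integrable).symm.trans
      (hZ i).integral_eq_zero
  · have hindep : iIndepFun (fun i w => inner ℝ (u i) (Z i w)) P :=
      hind.comp (fun i z => inner ℝ (u i) z) fun i => by fun_prop
    calc Var[fun w => inner ℝ u (WithLp.toLp 2 fun i => Z i w); P]
        = Var[∑ i, fun w => inner ℝ (u i) (Z i w); P] := by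
          congr 1
          ext w
          rw [PiLp.inner_apply, Finset.sum_apply]
      _ = ∑ i, Var[fun w => inner ℝ (u i) (Z i w); P] :=
          IndepFun.variance_sum
            (fun i _ => (hasGaussianLaw_inner (hZ i).hasGaussianLaw _).memLp_two)
            fun i _ j _ hij => hindep.indepFun hij
      _ ≤ ∑ i, M * ‖u i‖ ^ 2 := Finset.sum_le_sum fun i _ => (hZ i).variance_inner_le _
      _ = M * ‖u‖ ^ 2 := by rw [← Finset.mul_sum, PiLp.norm_sq_eq_of_L2]

end IsCentredGaussianLE

end CentredGaussian

section Net

open Metric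

lemma packingNumber_half_le_of_subset_closedBall {E : Type*} [NormedAddCommGroup E]
    [NormedSpace ℝ E] [FiniteDimensional ℝ E] {A : Set E} (hA : A ⊆ closedBall 0 1) :
    packingNumber (1 / 2) A ≤ 5 ^ Module.finrank ℝ E := by
  classical
  have hcard : ∀ s : Finset E, (s : Set E) ⊆ A → IsSeparated (1 / 2 : NNReal) (s : Set E) →
      s.card ≤ 5 ^ Module.finrank ℝ E := fun s hs hsep => by
    rw [← Finset.card_image_of_injective s (smul_right_injective E (two_ne_zero' ℝ))]
    refine Besicovitch.card_le_of_separated _ ?_ ?_ <;> simp only [Finset.forall_mem_image]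
    · intro v hv
      have := mem_closedBall_zero_iff.1 (hA (hs hv))
      rw [norm_smul, Real.norm_two]
      linarith
    · intro v hv w hw hne
      have : ((1 / 2 : NNReal) : ENNReal) < edist v w := hsep hv hw (by rintro rfl; exact hne rfl)
      rw [edist_nndist, ENNReal.coe_lt_coe, ← NNReal.coe_lt_coe, coe_nndist, dist_eq_norm] at this
      rw [← smul_sub, norm_smul, Real.norm_two]
      push_cast at this
      linarith
  refine iSup_le fun C => iSup₂_le fun hC hsep => ?_
  have hfin : C.Finite := by
    by_contra hinf
    obtain ⟨s, hsC, hs⟩ := Set.Infinite.exists_subset_card_eq hinf (5 ^ Module.finrank ℝ E + 1)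
    have := hcard s (hsC.trans hC) (hsep.mono hsC)
    omega
  lift C to Finset E using hfin
  rw [Set.encard_coe_eq_coe_finsetCard]
  exact_mod_cast hcard C hC hsep

lemma exists_net_sphere (E : Type*) [NormedAddCommGroup E] [NormedSpace ℝ E]
    [FiniteDimensional ℝ E] :
    ∃ S : Finset E, S.card ≤ 5 ^ Module.finrank ℝ E ∧ (∀ v ∈ S, ‖v‖ = 1) ∧
      ∀ v : E, ‖v‖ = 1 → ∃ w ∈ S, ‖v - w‖ ≤ 1 / 2 := by
  have hle : coveringNumber (1 / 2) (sphere (0 : E) 1) ≤ 5 ^ Module.finrank ℝ E :=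
    (coveringNumber_le_packingNumber _ _).trans
      (packingNumber_half_le_of_subset_closedBall sphere_subset_closedBall)
  obtain ⟨C, hC, hfin, hcover, hcard⟩ := exists_set_encard_eq_coveringNumber
    (hle.trans_lt (by exact_mod_cast ENat.natCast_lt_top (5 ^ Module.finrank ℝ E))).ne
  lift C to Finset E using hfin
  rw [← hcard, Set.encard_coe_eq_coe_finsetCard] at hle
  refine ⟨C, by exact_mod_cast hle, fun v hv => by simpa using hC hv, fun v hv => ?_⟩
  simpa [dist_eq_norm] using
    isCover_iff_subset_iUnion_closedBall.1 hcover (mem_sphere_zero_iff_norm.2 hv)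

lemma norm_le_two_mul_norm_inner_of_eigenvector {𝕜 E : Type*} [RCLike 𝕜] [NormedAddCommGroup E]
    [InnerProductSpace 𝕜 E] {T : E →L[𝕜] E} (hT : (T : E →ₗ[𝕜] E).IsSymmetric) {l : ℝ}
    (hl : |l| = ‖T‖) {v w : E} (hTv : T v = (l : 𝕜) • v) (hw : ‖w‖ = 1) (hvw : ‖v - w‖ ≤ 1 / 2) :
    ‖T‖ ≤ 2 * ‖inner 𝕜 w (T w)‖ := by
  have hTv' : ∀ u, inner 𝕜 v (T u) = l * inner 𝕜 v u := fun u => by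
    rw [← ContinuousLinearMap.coe_coe, ← hT, ContinuousLinearMap.coe_coe, hTv, inner_smul_left,
      RCLike.conj_ofReal]
  have hexpand : inner 𝕜 w (T w) - l
      = inner 𝕜 (v - w) (T (v - w)) - l * inner 𝕜 (v - w) (v - w) := by
    have hww : inner 𝕜 w w = (1 : 𝕜) := by simp [inner_self_eq_norm_sq_to_K, hw]
    simp only [map_sub, inner_sub_left, inner_sub_right, hTv, hTv', inner_smul_right, hww]
    ring
  have hdiff : ‖inner 𝕜 w (T w) - l‖ ≤ 2 * ‖T‖ * ‖v - w‖ ^ 2 :=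
    calc ‖inner 𝕜 w (T w) - l‖
        ≤ ‖inner 𝕜 (v - w) (T (v - w))‖ + ‖l * inner 𝕜 (v - w) (v - w)‖ :=
          hexpand ▸ norm_sub_le _ _
      _ ≤ ‖v - w‖ * (‖T‖ * ‖v - w‖) + ‖T‖ * (‖v - w‖ * ‖v - w‖) := by
          rw [norm_mul, RCLike.norm_ofReal, hl]
          gcongr
          · exact (norm_inner_le_norm _ _).trans (by gcongr; exact T.le_opNorm _)
          · exact norm_inner_le_norm _ _
      _ = 2 * ‖T‖ * ‖v - w‖ ^ 2 := by ring
  have hle : ‖T‖ ≤ ‖inner 𝕜 w (T w)‖ + ‖inner 𝕜 w (T w) - l‖ := by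
    rw [← hl, ← RCLike.norm_ofReal (K := 𝕜)]
    exact norm_sub_rev (l : 𝕜) _ ▸ norm_le_norm_add_norm_sub' _ _
  have hsq : ‖v - w‖ ^ 2 ≤ (1 / 2) ^ 2 := by gcongr
  nlinarith [mul_le_mul_of_nonneg_left hsq (norm_nonneg T)]

lemma exists_unit_eigenvector_abs_eq_norm {E : Type*} [NormedAddCommGroup E]
    [InnerProductSpace ℂ E] [FiniteDimensional ℂ E] [Nontrivial E] {T : E →L[ℂ] E}
    (hT : IsSelfAdjoint T) :
    ∃ (l : ℝ) (v : E), |l| = ‖T‖ ∧ ‖v‖ = 1 ∧ T v = (l : ℂ) • v := by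
  have := FiniteDimensional.complete ℂ E
  obtain ⟨l, hl, hlT⟩ := spectrum.exists_nnnorm_eq_spectralRadius T
  rw [IsSelfAdjoint.spectralRadius_eq_nnnorm hT, ENNReal.coe_inj] at hlT
  have hre : l = l.re := hT.mem_spectrum_eq_re hl
  have heig : Module.End.HasEigenvalue (T : E →ₗ[ℂ] E) l := by
    rwa [Module.End.hasEigenvalue_iff_mem_spectrum,
      ← AlgEquiv.spectrum_eq (Module.End.toContinuousLinearMap E)]
  obtain ⟨v, hv⟩ := heig.exists_hasEigenvector
  refine ⟨l.re, ((‖v‖⁻¹ : ℝ) : ℂ) • v, ?_, ?_, ?_⟩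
  · rw [← Real.norm_eq_abs, ← Complex.norm_real, ← hre]
    exact congrArg NNReal.toReal hlT
  · simp [norm_smul, hv.2]
  · rw [map_smul, smul_comm, ← hre]
    exact congrArg _ hv.apply_eq_smul

lemma exists_net_norm_isHermitian_le (m : Type*) [Fintype m] [DecidableEq m] [Nonempty m] :
    ∃ S : Finset (EuclideanSpace ℂ m), S.card ≤ 25 ^ Fintype.card m ∧ (∀ v ∈ S, ‖v‖ = 1) ∧
      ∀ A : Matrix m m ℂ, A.IsHermitian → ∃ v ∈ S,
        ‖A‖ ≤ 2 * ‖star v.ofLp ⬝ᵥ A.mulVec v.ofLp‖ := by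
  obtain ⟨S, hS, hS1, hnet⟩ := exists_net_sphere (EuclideanSpace ℂ m)
  rw [finrank_real_of_complex, finrank_euclideanSpace, pow_mul] at hS
  refine ⟨S, hS, hS1, fun A hA => ?_⟩
  have hself : IsSelfAdjoint (Matrix.toEuclideanCLM (𝕜 := ℂ) A) :=
    hA.isSelfAdjoint.map Matrix.toEuclideanCLM
  obtain ⟨l, v, hl, hv, hAv⟩ := exists_unit_eigenvector_abs_eq_norm hself
  obtain ⟨w, hwS, hvw⟩ := hnet v hv
  refine ⟨w, hwS, ?_⟩
  have := norm_le_two_mul_norm_inner_of_eigenvector hself.isSymmetric hl hAv (hS1 w hwS) hvw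
  rwa [EuclideanSpace.inner_eq_star_dotProduct, dotProduct_comm] at this

end Net

section SpectrogramTail

variable {Ω : Type*} [MeasurableSpace Ω] {P : Measure Ω} {M : ℝ}

lemma opNorm_sum_smulRight_proj_le {ι F : Type*} [Fintype ι] [NormedAddCommGroup F]
    [NormedSpace ℝ F] (c : ι → F) :
    ‖∑ t, (EuclideanSpace.proj t : EuclideanSpace ℝ ι →L[ℝ] ℝ).smulRight (c t)‖
      ≤ √(∑ t, ‖c t‖ ^ 2) := by
  refine ContinuousLinearMap.opNorm_le_bound _ (Real.sqrt_nonneg _) fun y => ?_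
  calc ‖(∑ t, (EuclideanSpace.proj t : EuclideanSpace ℝ ι →L[ℝ] ℝ).smulRight (c t)) y‖
      ≤ ∑ t, ‖c t‖ * ‖y t‖ := by
        rw [sum_apply]
        refine norm_sum_le_of_le _ fun t _ => ?_
        rw [ContinuousLinearMap.smulRight_apply, norm_smul, mul_comm, PiLp.proj_apply]
    _ ≤ √(∑ t, ‖c t‖ ^ 2) * ‖y‖ := by
        rw [EuclideanSpace.norm_eq]
        exact Real.sum_mul_le_sqrt_mul_sqrt _ _ _

lemma IsCentredGaussianLE.map_blocks {ι E F : Type*} [Fintype ι]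
    [NormedAddCommGroup E] [InnerProductSpace ℝ E] [FiniteDimensional ℝ E] [MeasurableSpace E]
    [BorelSpace E] [NormedAddCommGroup F] [InnerProductSpace ℝ F] [CompleteSpace F]
    [SecondCountableTopology F] [MeasurableSpace F] [BorelSpace F]
    {Z : ι → Ω → E} (hM : 0 ≤ M)
    (hZ : IsCentredGaussianLE (E := PiLp 2 fun _ : ι => E) (fun w => WithLp.toLp 2 fun i => Z i w)
      M P) {A : E →L[ℝ] F} (hA : ‖A‖ ≤ 1) :
    IsCentredGaussianLE (E := PiLp 2 fun _ : ι => F) (fun w => WithLp.toLp 2 fun i => A (Z i w))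
      M P := by
  let B : (PiLp 2 fun _ : ι => E) →L[ℝ] PiLp 2 fun _ : ι => F :=
    (PiLp.continuousLinearEquiv 2 ℝ fun _ : ι => F).symm.toContinuousLinearMap ∘L
      ContinuousLinearMap.pi fun i => A ∘L PiLp.proj 2 (fun _ : ι => E) i
  have hB : ‖B‖ ≤ 1 := ContinuousLinearMap.opNorm_le_bound _ zero_le_one fun z => by
    rw [one_mul, ← sq_le_sq₀ (norm_nonneg _) (norm_nonneg _), PiLp.norm_sq_eq_of_L2,
      PiLp.norm_sq_eq_of_L2]
    gcongr with i
    exact (A.le_of_opNorm_le hA _).trans_eq (one_mul _)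
  exact hZ.map hM hB

variable {p n N : ℕ}

lemma star_dotProduct_outer_mulVec (v x : Fin p → ℂ) :
    star v ⬝ᵥ (outer x).mulVec v = (‖star v ⬝ᵥ x‖ ^ 2 : ℝ) := by
  have hconj : star x ⬝ᵥ v = (starRingEnd ℂ) (star v ⬝ᵥ x) := by
    rw [starRingEnd_apply, Matrix.star_dotProduct]
  rw [outer, Matrix.vecMulVec_mulVec, dotProduct_smul, hconj, Complex.ofReal_pow,
    ← Complex.mul_conj']
  rfl

lemma isHermitian_outer (x : Fin p → ℂ) : (outer x).IsHermitian := by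
  rw [Matrix.IsHermitian, outer, Matrix.conjTranspose_vecMulVec, star_star]

lemma isHermitian_dftCov (y : Ω → Fin N → Fin p → ℝ) (θ : ℝ) : (dftCov P y θ).IsHermitian := by
  ext i j
  simp only [Matrix.conjTranspose_apply, dftCov, Matrix.of_apply]
  rw [← starRingEnd_apply, ← integral_conj]
  congr 1
  ext w
  exact (isHermitian_outer (dft (y w) θ)).apply i j

lemma isHermitian_one_div_natCast_smul_sum (n : ℕ) {B : Fin n → Matrix (Fin p) (Fin p) ℂ}
    (hB : ∀ r, (B r).IsHermitian) : ((1 / n : ℂ) • ∑ r, B r).IsHermitian := by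
  rw [Matrix.IsHermitian, Matrix.conjTranspose_smul, Matrix.conjTranspose_sum]
  congr 1
  · simp
  · exact Finset.sum_congr rfl fun r _ => hB r

lemma memLp_dft {y : Ω → Fin N → Fin p → ℝ} (hy : ∀ k i, MemLp (fun w => y w k i) 2 P) (θ : ℝ)
    (i : Fin p) : MemLp (fun w => dft (y w) θ i) 2 P := by
  have hsum : MemLp (fun w => ∑ k : Fin N, (y w k i : ℂ) *
      Complex.exp (-(Complex.I * θ * (k : ℕ)))) 2 P :=
    memLp_finsetSum _ fun k _ => (hy k i).ofReal.mul_const _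
  exact hsum.const_mul _

lemma integrable_outer_dft {y : Ω → Fin N → Fin p → ℝ}
    (hy : ∀ k i, MemLp (fun w => y w k i) 2 P) (θ : ℝ) (i j : Fin p) :
    Integrable (fun w => outer (dft (y w) θ) i j) P :=
  (memLp_dft hy θ i).integrable_mul (memLp_dft hy θ j).star

lemma star_dotProduct_dftCov_mulVec {y : Ω → Fin N → Fin p → ℝ}
    (hy : ∀ k i, MemLp (fun w => y w k i) 2 P) (θ : ℝ) (v : Fin p → ℂ) :
    star v ⬝ᵥ (dftCov P y θ).mulVec v = (∫ w, ‖star v ⬝ᵥ dft (y w) θ‖ ^ 2 ∂P : ℝ) := by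
  have hI := integrable_outer_dft hy θ
  rw [← integral_complex_ofReal]
  simp_rw [← star_dotProduct_outer_mulVec]
  simp only [dotProduct, Matrix.mulVec, dftCov, Matrix.of_apply]
  rw [integral_finsetSum _ fun i _ =>
    (integrable_finsetSum _ fun j _ => (hI i j).mul_const _).const_mul _]
  refine Finset.sum_congr rfl fun i _ => ?_
  rw [integral_const_mul, integral_finsetSum _ fun j _ => (hI i j).mul_const _]
  simp_rw [integral_mul_const]

/-- The coefficients of `v* x(θ)` as a linear functional of the trajectory, where `x(θ)` is the
normalised Fourier transform. -/
def dftCoeff (N : ℕ) (v : Fin p → ℂ) (θ : ℝ) (t : Fin N × Fin p) : ℂ :=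
  (1 / √N : ℝ) * Complex.exp (-(Complex.I * θ * (t.1 : ℕ))) * star (v t.2)

/-- A trajectory as a vector of the Euclidean space of dimension `N p`. -/
def flatten (y : Fin N → Fin p → ℝ) : EuclideanSpace ℝ (Fin N × Fin p) :=
  WithLp.toLp 2 fun t => y t.1 t.2

/-- The functional `y ↦ v* x(θ)`, where `x(θ)` is the normalised Fourier transform of `y`. -/
def dftFunctional (N : ℕ) (v : Fin p → ℂ) (θ : ℝ) : EuclideanSpace ℝ (Fin N × Fin p) →L[ℝ] ℂ :=
  ∑ t, (EuclideanSpace.proj t).smulRight (dftCoeff N v θ t)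

lemma dftFunctional_flatten (v : Fin p → ℂ) (θ : ℝ) (y : Fin N → Fin p → ℝ) :
    dftFunctional N v θ (flatten y) = star v ⬝ᵥ dft y θ := by
  simp only [dftFunctional, sum_apply, ContinuousLinearMap.smulRight_apply, dftCoeff, flatten,
    PiLp.proj_apply, Complex.real_smul, Fintype.sum_prod_type_right, dotProduct, dft,
    Finset.mul_sum, Pi.star_apply]
  refine Finset.sum_congr rfl fun i _ => Finset.sum_congr rfl fun k _ => ?_
  ring

lemma norm_dftFunctional_le (hN : 0 < N) (v : EuclideanSpace ℂ (Fin p)) (θ : ℝ) :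
    ‖dftFunctional N v.ofLp θ‖ ≤ ‖v‖ := by
  refine (opNorm_sum_smulRight_proj_le _).trans_eq ?_
  have hexp : ∀ k : Fin N, ‖Complex.exp (-(Complex.I * θ * (k : ℕ)))‖ = 1 := fun k => by
    rw [Complex.norm_exp]
    simp
  have hcoeff : ∀ t, ‖dftCoeff N v.ofLp θ t‖ ^ 2 = (N : ℝ)⁻¹ * ‖v t.2‖ ^ 2 := fun t => by
    rw [dftCoeff, norm_mul, norm_mul, norm_star, Complex.norm_real, hexp, mul_one, mul_pow,
      Real.norm_eq_abs, sq_abs, div_pow, Real.sq_sqrt (by positivity), one_pow, one_div]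
  have hN' : (N : ℝ) ≠ 0 := by positivity
  simp_rw [hcoeff, Fintype.sum_prod_type, ← Finset.mul_sum, ← EuclideanSpace.norm_sq_eq]
  simp [hN']

lemma star_dotProduct_spectrogram_mulVec (y : Fin n → Fin N → Fin p → ℝ) (θ : ℝ)
    (v : Fin p → ℂ) :
    star v ⬝ᵥ (spectrogram y θ).mulVec v
      = (1 / n * ‖WithLp.toLp 2 fun r => dftFunctional N v θ (flatten (y r))‖ ^ 2 : ℝ) := by
  rw [spectrogram, Matrix.smul_mulVec, dotProduct_smul, Matrix.sum_mulVec, dotProduct_sum,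
    PiLp.norm_sq_eq_of_L2]
  simp [star_dotProduct_outer_mulVec, dftFunctional_flatten]

/-- The expectation `(1/n) ∑_r E[x^r(θ) x^r(θ)*]` of the spectrogram. -/
def meanSpectrogram (P : Measure Ω) (y : Fin n → Ω → Fin N → Fin p → ℝ) (θ : ℝ) :
    Matrix (Fin p) (Fin p) ℂ :=
  (1 / n : ℂ) • ∑ r, dftCov P (y r) θ

lemma isHermitian_spectrogram_sub_meanSpectrogram (z : Fin n → Fin N → Fin p → ℝ)
    (y : Fin n → Ω → Fin N → Fin p → ℝ) (θ : ℝ) :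
    (spectrogram z θ - meanSpectrogram P y θ).IsHermitian :=
  (isHermitian_one_div_natCast_smul_sum n fun _ => isHermitian_outer _).sub
    (isHermitian_one_div_natCast_smul_sum n fun _ => isHermitian_dftCov _ _)

lemma star_dotProduct_meanSpectrogram_mulVec {y : Fin n → Ω → Fin N → Fin p → ℝ}
    (hy : ∀ r k i, MemLp (fun w => y r w k i) 2 P) (θ : ℝ) (v : Fin p → ℂ) :
    star v ⬝ᵥ (meanSpectrogram P y θ).mulVec v
      = (1 / n * ∫ w, ‖WithLp.toLp 2 fun r => dftFunctional N v θ (flatten (y r w))‖ ^ 2 ∂P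
          : ℝ) := by
  have hint : ∀ r, Integrable (fun w => ‖star v ⬝ᵥ dft (y r w) θ‖ ^ 2) P := fun r =>
    have hmem : MemLp (fun w => star v ⬝ᵥ dft (y r w) θ) 2 P :=
      memLp_finsetSum _ fun i _ => (memLp_dft (hy r) θ i).const_mul _
    hmem.integrable_norm_pow two_ne_zero
  simp_rw [PiLp.norm_sq_eq_of_L2, dftFunctional_flatten]
  rw [integral_finsetSum _ fun r _ => hint r, meanSpectrogram, Matrix.smul_mulVec, dotProduct_smul,
    Matrix.sum_mulVec, dotProduct_sum]
  simp [star_dotProduct_dftCov_mulVec (hy _)]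

lemma measureReal_quadraticForm_spectrogram_ge_le (hn : 0 < n) (hN : 0 < N) (hM : 0 < M)
    {y : Fin n → Ω → Fin N → Fin p → ℝ}
    (hy : IsCentredGaussianLE (E := PiLp 2 fun _ : Fin n => EuclideanSpace ℝ (Fin N × Fin p))
      (fun w => WithLp.toLp 2 fun r => flatten (y r w)) M P) {θ : ℝ}
    {v : EuclideanSpace ℂ (Fin p)} (hv : ‖v‖ = 1) {δ : ℝ} (hδ : 0 ≤ δ) (hδM : δ ≤ 6 * M) :
    P.real {w | δ ≤ ‖star v.ofLp ⬝ᵥ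
        (spectrogram (fun r => y r w) θ - meanSpectrogram P y θ).mulVec v.ofLp‖}
      ≤ 2 * Real.exp (-(δ ^ 2 * n / (32 * M ^ 2))) := by
  have : Nonempty (Fin n) := ⟨0, hn⟩
  have hmem : ∀ r k i, MemLp (fun w => y r w k i) 2 P := fun r k i =>
    (hy.hasGaussianLaw.map_fun
      (EuclideanSpace.proj (k, i) ∘L PiLp.proj (𝕜 := ℝ) 2 _ r)).memLp_two
  let ζ : Ω → PiLp 2 fun _ : Fin n => ℂ := fun w =>
    WithLp.toLp 2 fun r => dftFunctional N v.ofLp θ (flatten (y r w))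
  have hζ : IsCentredGaussianLE ζ M P :=
    hy.map_blocks hM.le ((norm_dftFunctional_le hN v θ).trans_eq hv)
  have hrank : (Module.finrank ℝ (PiLp 2 fun _ : Fin n => ℂ) : ℝ) = 2 * n := by
    rw [finrank_real_of_complex]
    simp
  have hn' : (0 : ℝ) < n := by positivity
  calc P.real {w | δ ≤ ‖star v.ofLp ⬝ᵥ
        (spectrogram (fun r => y r w) θ - meanSpectrogram P y θ).mulVec v.ofLp‖}
      = P.real {w | n * δ ≤ |‖ζ w‖ ^ 2 - ∫ w, ‖ζ w‖ ^ 2 ∂P|} := by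
        congr 1
        ext w
        rw [Set.mem_ofPred_eq, Set.mem_ofPred_eq, Matrix.sub_mulVec, dotProduct_sub,
          star_dotProduct_spectrogram_mulVec, star_dotProduct_meanSpectrogram_mulVec hmem,
          ← Complex.ofReal_sub, Complex.norm_real, ← mul_sub, Real.norm_eq_abs, abs_mul,
          abs_of_pos (by positivity), one_div, le_inv_mul_iff₀ hn']
    _ ≤ 2 * Real.exp (-((n * δ) ^ 2 / (16 * (2 * n) * M ^ 2))) :=
        hrank ▸ hζ.measureReal_abs_norm_sq_sub_ge_le hM (by positivity)
          (by rw [hrank]; nlinarith)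
    _ = 2 * Real.exp (-(δ ^ 2 * n / (32 * M ^ 2))) := by
        congr 3
        field_simp
        ring

lemma measureReal_norm_isHermitian_ge_le {n : Type*} [Fintype n] [DecidableEq n] [Nonempty n]
    [IsFiniteMeasure P] {B : Ω → Matrix n n ℂ} (hB : ∀ w, (B w).IsHermitian) {ε q : ℝ}
    (hq : ∀ v : EuclideanSpace ℂ n, ‖v‖ = 1 →
      P.real {w | ε / 2 ≤ ‖star v.ofLp ⬝ᵥ (B w).mulVec v.ofLp‖} ≤ q) :
    P.real {w | ε ≤ ‖B w‖} ≤ 25 ^ Fintype.card n * q := by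
  obtain ⟨S, hS, hS1, hnet⟩ := exists_net_norm_isHermitian_le n
  have hsub : {w | ε ≤ ‖B w‖} ⊆ ⋃ v ∈ S, {w | ε / 2 ≤ ‖star v.ofLp ⬝ᵥ (B w).mulVec v.ofLp‖} := by
    intro w (hw : ε ≤ ‖B w‖)
    obtain ⟨v, hvS, hle⟩ := hnet _ (hB w)
    refine Set.mem_iUnion₂.2 ⟨v, hvS, ?_⟩
    rw [Set.mem_ofPred_eq]
    linarith
  obtain ⟨u, hu⟩ := exists_norm_eq (EuclideanSpace ℂ n) zero_le_one
  have hq₀ : 0 ≤ q := measureReal_nonneg.trans (hq u hu)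
  calc P.real {w | ε ≤ ‖B w‖}
      ≤ ∑ v ∈ S, P.real {w | ε / 2 ≤ ‖star v.ofLp ⬝ᵥ (B w).mulVec v.ofLp‖} :=
        (measureReal_mono hsub (measure_ne_top _ _)).trans (measureReal_biUnion_finset_le _ _)
    _ ≤ S.card * q := by
        rw [← nsmul_eq_mul]
        exact Finset.sum_le_card_nsmul _ _ _ fun v hv => hq v (hS1 v hv)
    _ ≤ 25 ^ Fintype.card n * q := by
        gcongr
        exact_mod_cast hS

lemma two_mul_twentyFive_pow_le_exp {p : ℕ} (hp : p ≠ 0) :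
    2 * (25 : ℝ) ^ p ≤ Real.exp (6 * p) := by
  have hexp : (50 : ℝ) ≤ Real.exp 6 :=
    calc (50 : ℝ) ≤ 2 ^ 6 := by norm_num
      _ ≤ Real.exp 1 ^ 6 := by gcongr; linarith [Real.add_one_le_exp 1]
      _ = Real.exp 6 := by rw [← Real.exp_nat_mul]; norm_num
  calc (2 : ℝ) * 25 ^ p ≤ 2 ^ p * 25 ^ p := by
        gcongr
        exact le_self_pow₀ (by norm_num) hp
    _ = 50 ^ p := by rw [← mul_pow]; norm_num
    _ ≤ Real.exp 6 ^ p := by gcongr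
    _ = Real.exp (6 * p) := by rw [← Real.exp_nat_mul, mul_comm]

lemma measureReal_spectrogram_sub_meanSpectrogram_ge_le (hn : 0 < n) (hN : 0 < N) (hM : 0 < M)
    {y : Fin n → Ω → Fin N → Fin p → ℝ}
    (hy : IsCentredGaussianLE (E := PiLp 2 fun _ : Fin n => EuclideanSpace ℝ (Fin N × Fin p))
      (fun w => WithLp.toLp 2 fun r => flatten (y r w)) M P) (θ : ℝ)
    {ε : ℝ} (hε : 0 ≤ ε) (hεM : ε ≤ 12 * M) :
    P.real {w | ε ≤ ‖spectrogram (fun r => y r w) θ - meanSpectrogram P y θ‖}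
      ≤ Real.exp (-(ε ^ 2 * n / (128 * M ^ 2)) + 6 * p) := by
  have := hy.hasGaussianLaw.isProbabilityMeasure
  rcases eq_or_ne p 0 with rfl | hp
  · rcases hε.eq_or_lt with rfl | hε
    · simp
    · simp only [Subsingleton.elim _ (0 : Matrix (Fin 0) (Fin 0) ℂ), norm_zero, hε.not_ge]
      simpa using Real.exp_nonneg _
  have : NeZero p := ⟨hp⟩
  calc P.real {w | ε ≤ ‖spectrogram (fun r => y r w) θ - meanSpectrogram P y θ‖}
      ≤ 25 ^ p * (2 * Real.exp (-((ε / 2) ^ 2 * n / (32 * M ^ 2)))) := by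
        simpa only [Fintype.card_fin] using measureReal_norm_isHermitian_ge_le
          (fun w => isHermitian_spectrogram_sub_meanSpectrogram (fun r => y r w) y θ)
          fun v hv => measureReal_quadraticForm_spectrogram_ge_le hn hN hM hy hv
            (by positivity) (by linarith)
    _ = 2 * 25 ^ p * Real.exp (-(ε ^ 2 * n / (128 * M ^ 2))) := by
        rw [show (ε / 2) ^ 2 * n / (32 * M ^ 2) = ε ^ 2 * n / (128 * M ^ 2) by field_simp; ring]
        ring
    _ ≤ Real.exp (6 * p) * Real.exp (-(ε ^ 2 * n / (128 * M ^ 2))) := by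
        gcongr
        exact two_mul_twentyFive_pow_le_exp hp
    _ = Real.exp (-(ε ^ 2 * n / (128 * M ^ 2)) + 6 * p) := by rw [← Real.exp_add, add_comm]

end SpectrogramTail

section FourierSeries

lemma norm_cexp_neg_I_mul (θ : ℝ) (k : ℤ) : ‖Complex.exp (-(Complex.I * θ * k))‖ = 1 := by
  rw [Complex.norm_exp]
  simp

lemma integral_cexp_int (m : ℤ) :
    ∫ θ in (0 : ℝ)..2 * Real.pi, Complex.exp (Complex.I * θ * m)
      = if m = 0 then (2 * Real.pi : ℂ) else 0 := by
  split_ifs with hm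
  · simp [hm]
  · simp_rw [mul_right_comm Complex.I _ (m : ℂ)]
    rw [integral_exp_mul_complex (by simp [hm]),
      Complex.exp_eq_one_iff.2 ⟨m, by push_cast; ring⟩]
    simp

lemma continuous_tsum_mul_cexp {a : ℤ → ℂ} (ha : Summable fun k => ‖a k‖) :
    Continuous fun θ : ℝ => ∑' k, a k * Complex.exp (-(Complex.I * θ * k)) :=
  continuous_tsum (fun k => by fun_prop) ha fun k θ => by
    rw [norm_mul, norm_cexp_neg_I_mul, mul_one]

lemma integral_tsum_mul_cexp {a : ℤ → ℂ} (ha : Summable fun k => ‖a k‖) (m : ℤ) :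
    ∫ θ in (0 : ℝ)..2 * Real.pi, (∑' k, a k * Complex.exp (-(Complex.I * θ * k)))
        * Complex.exp (Complex.I * θ * m) = 2 * Real.pi * a m := by
  have hshift : ∀ (θ : ℝ) (k : ℤ), a k * Complex.exp (-(Complex.I * θ * k)) *
      Complex.exp (Complex.I * θ * m) = a k * Complex.exp (Complex.I * θ * (m - k : ℤ)) :=
    fun θ k => by
      rw [mul_assoc, ← Complex.exp_add]
      push_cast
      ring_nf
  have hsum := intervalIntegral.hasSum_integral_of_dominated_convergence (μ := volume)
    (a := 0) (b := 2 * Real.pi) (F := fun k θ => a k * Complex.exp (Complex.I * θ * (m - k : ℤ)))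
    (f := fun θ => ∑' k, a k * Complex.exp (Complex.I * θ * (m - k : ℤ)))
    (fun k _ => ‖a k‖) (fun k => Continuous.aestronglyMeasurable (by fun_prop))
    (fun k => .of_forall fun θ _ => by simp [Complex.norm_exp])
    (.of_forall fun _ _ => ha) intervalIntegrable_const
    (.of_forall fun θ _ => (Summable.of_norm (by simpa [Complex.norm_exp])).hasSum)
  simp_rw [← tsum_mul_right, hshift, ← hsum.tsum_eq, intervalIntegral.integral_const_mul,
    integral_cexp_int, sub_eq_zero]
  rw [tsum_eq_single m fun k hk => by simp [hk.symm]]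
  simp [mul_comm]

variable {m T : Type*}

/-- The Fourier series `∑ₖ R(k) e^{-iθk}` of a sequence of matrices. -/
def symbol (R : ℤ → Matrix m m ℝ) (θ : ℝ) : Matrix m m ℂ :=
  Matrix.of fun i j => ∑' k : ℤ, (R k i j : ℂ) * Complex.exp (-(Complex.I * θ * k))

lemma continuous_symbol_apply {R : ℤ → Matrix m m ℝ} {i j : m} (hR : Summable fun k => R k i j) :
    Continuous fun θ => symbol R θ i j :=
  continuous_tsum_mul_cexp (by simpa using hR.norm)

variable [DecidableEq m]

lemma symbol_single_zero_one (θ : ℝ) :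
    symbol (Pi.single 0 1 : ℤ → Matrix m m ℝ) θ = 1 := by
  ext i j
  rw [symbol, Matrix.of_apply, tsum_eq_single 0 fun k hk => by simp [Pi.single_eq_of_ne hk]]
  simp [Matrix.one_apply, apply_ite]

variable [Fintype T]

/-- The trigonometric polynomial `∑ₜ cₜ e^{-iθkₜ} δ_{iₜ}` in `ℂ ^ m`, where `τ t = (iₜ, kₜ)`. -/
def trigPolynomial (τ : T → m × ℤ) (c : T → ℝ) (θ : ℝ) : m → ℂ :=
  ∑ t, Pi.single (τ t).1 (c t * Complex.exp (-(Complex.I * θ * (τ t).2)))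

variable [Fintype m]

lemma star_trigPolynomial_dotProduct_mulVec (τ : T → m × ℤ) (c : T → ℝ) (θ : ℝ)
    (A : Matrix m m ℂ) :
    star (trigPolynomial τ c θ) ⬝ᵥ A.mulVec (trigPolynomial τ c θ)
      = ∑ s, ∑ t, ((c s * c t : ℝ) : ℂ) * (A (τ s).1 (τ t).1 *
        Complex.exp (Complex.I * θ * ((τ s).2 - (τ t).2 : ℤ))) := by
  have hconj : ∀ k : ℤ, (starRingEnd ℂ) (Complex.exp (-(Complex.I * θ * k)))
      = Complex.exp (Complex.I * θ * k) := fun k => by simp [← Complex.exp_conj]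
  simp only [trigPolynomial, star_sum, Matrix.mulVec_sum, sum_dotProduct, dotProduct_sum,
    Pi.star_single, single_dotProduct, Matrix.mulVec_single, Matrix.col_apply, Pi.smul_apply,
    op_smul_eq_mul, star_mul', Complex.star_def, Complex.conj_ofReal, hconj]
  rw [Finset.sum_comm]
  refine Finset.sum_congr rfl fun s _ => Finset.sum_congr rfl fun t _ => ?_
  have hexp : Complex.exp (Complex.I * θ * ((τ s).2 - (τ t).2 : ℤ))
      = Complex.exp (Complex.I * θ * (τ s).2) * Complex.exp (-(Complex.I * θ * (τ t).2)) := by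
    rw [← Complex.exp_add]
    push_cast
    ring_nf
  rw [hexp]
  push_cast
  ring

variable {R : ℤ → Matrix m m ℝ} (τ : T → m × ℤ) (c : T → ℝ)

lemma continuous_quadraticForm_symbol (hR : ∀ i j, Summable fun k => R k i j) :
    Continuous fun θ =>
      star (trigPolynomial τ c θ) ⬝ᵥ (symbol R θ).mulVec (trigPolynomial τ c θ) := by
  simp_rw [star_trigPolynomial_dotProduct_mulVec]
  have := fun i j => continuous_symbol_apply (hR i j)
  fun_prop

lemma integral_quadraticForm_symbol (hR : ∀ i j, Summable fun k => R k i j) :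
    ∫ θ in (0 : ℝ)..2 * Real.pi,
        (star (trigPolynomial τ c θ) ⬝ᵥ (symbol R θ).mulVec (trigPolynomial τ c θ)).re
      = 2 * Real.pi * ∑ s, ∑ t, c s * c t * R ((τ s).2 - (τ t).2) (τ s).1 (τ t).1 := by
  have hre := Complex.reCLM.intervalIntegral_comp_comm
    ((continuous_quadraticForm_symbol τ c hR).intervalIntegrable (μ := volume) 0 (2 * Real.pi))
  simp only [Complex.reCLM_apply] at hre
  have hcont : ∀ s t, Continuous fun θ : ℝ => ((c s * c t : ℝ) : ℂ) *
      (symbol R θ (τ s).1 (τ t).1 * Complex.exp (Complex.I * θ * ((τ s).2 - (τ t).2 : ℤ))) :=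
    fun s t => continuous_const.mul ((continuous_symbol_apply (hR _ _)).mul (by fun_prop))
  have hcoeff : ∀ (i j : m) (k : ℤ), ∫ θ in (0 : ℝ)..2 * Real.pi,
      symbol R θ i j * Complex.exp (Complex.I * θ * k) = 2 * Real.pi * R k i j := fun i j k =>
    integral_tsum_mul_cexp (by simpa using (hR i j).norm) k
  rw [hre]
  simp_rw [star_trigPolynomial_dotProduct_mulVec]
  rw [intervalIntegral.integral_finsetSum fun s _ => Continuous.intervalIntegrable
    (continuous_finsetSum _ fun t _ => hcont s t) _ _]
  simp_rw [intervalIntegral.integral_finsetSum fun t _ => Continuous.intervalIntegrable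
    (hcont _ t) _ _, intervalIntegral.integral_const_mul, hcoeff]
  rw [← Complex.ofReal_re (2 * Real.pi * _)]
  push_cast
  simp_rw [Finset.mul_sum, mul_left_comm]

lemma integral_star_dotProduct_trigPolynomial (hτ : Function.Injective τ) :
    ∫ θ in (0 : ℝ)..2 * Real.pi, (star (trigPolynomial τ c θ) ⬝ᵥ trigPolynomial τ c θ).re
      = 2 * Real.pi * ∑ t, c t ^ 2 := by
  classical
  have hone : ∀ i j, Summable fun k => (Pi.single 0 1 : ℤ → Matrix m m ℝ) k i j := fun i j =>
    summable_of_ne_finset_zero (s := {0}) fun k hk => by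
      rw [Pi.single_eq_of_ne (by simpa using hk), Matrix.zero_apply]
  have hdelta : ∀ s t, (Pi.single 0 1 : ℤ → Matrix m m ℝ) ((τ s).2 - (τ t).2) (τ s).1 (τ t).1
      = if s = t then 1 else 0 := fun s t => by
    rw [← hτ.eq_iff (a := s), Prod.ext_iff, and_comm]
    by_cases hst : (τ s).2 = (τ t).2
    · simp [hst, Matrix.one_apply]
    · rw [Pi.single_eq_of_ne (sub_ne_zero.2 hst), Matrix.zero_apply, if_neg fun h => hst h.1]
  have := integral_quadraticForm_symbol τ c hone
  simp_rw [symbol_single_zero_one, Matrix.one_mulVec, hdelta] at this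
  simpa [← sq] using this

omit [DecidableEq m] in
lemma sum_mul_mul_le_of_symbol_le (hR : ∀ i j, Summable fun k => R k i j) {M : ℝ}
    (hM : ∀ θ ∈ Set.Icc 0 (2 * Real.pi), ∀ v : m → ℂ,
      (star v ⬝ᵥ (symbol R θ).mulVec v).re ≤ M * (star v ⬝ᵥ v).re)
    {τ : T → m × ℤ} (hτ : Function.Injective τ) (c : T → ℝ) :
    ∑ s, ∑ t, c s * c t * R ((τ s).2 - (τ t).2) (τ s).1 (τ t).1 ≤ M * ∑ t, c t ^ 2 := by
  classical
  have hcont : Continuous fun θ => trigPolynomial τ c θ := by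
    unfold trigPolynomial
    exact continuous_finsetSum _ fun t _ => (continuous_single _).comp (by fun_prop)
  have hmono := intervalIntegral.integral_mono_on (μ := volume) (by positivity)
    ((Complex.continuous_re.comp (continuous_quadraticForm_symbol τ c hR)).intervalIntegrable
      0 (2 * Real.pi))
    (Continuous.intervalIntegrable (by fun_prop) _ _)
    fun θ hθ => hM θ hθ (trigPolynomial τ c θ)
  rw [intervalIntegral.integral_const_mul, integral_star_dotProduct_trigPolynomial τ c hτ] at hmono
  simp only [Function.comp_apply] at hmono
  rw [integral_quadraticForm_symbol τ c hR, mul_left_comm] at hmono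
  exact le_of_mul_le_mul_left hmono (by positivity)

end FourierSeries

section StationaryGaussian

variable {Ω : Type*} [MeasurableSpace Ω] {μ : Measure Ω} {p : ℕ} {x : Fin p → ℤ → Ω → ℝ}

/-- A zero mean, wide-sense stationary, jointly Gaussian vector process with summable
auto-correlation, so that its power spectral density is defined. -/
structure IsStationaryGaussian (μ : Measure Ω) (x : Fin p → ℤ → Ω → ℝ) : Prop where
  gaussian : IsGaussianProcess (fun t : Fin p × ℤ => x t.1 t.2) μ
  mean_zero : ∀ i k, ∫ w, x i k w ∂μ = 0
  stationary : ∀ i j k m, ∫ w, x i k w * x j m w ∂μ = autocorr μ x (k - m) i j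
  summable : ∀ i j, Summable fun k => autocorr μ x k i j

/-- The power spectral density matrix of `x` is at most `M` in the Loewner order, at every
frequency in `[0, 2π]`. -/
def PSDLE (μ : Measure Ω) (x : Fin p → ℤ → Ω → ℝ) (M : ℝ) : Prop :=
  ∀ θ ∈ Set.Icc 0 (2 * Real.pi), ∀ v : Fin p → ℂ,
    (star v ⬝ᵥ (psd μ x θ).mulVec v).re ≤ M * (star v ⬝ᵥ v).re

section Eigenvalues

open scoped ComplexOrder MatrixOrder

lemma re_dotProduct_mulVec_le_of_eigenvalues_le {m : Type*} [Fintype m] [DecidableEq m]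
    {A : Matrix m m ℂ} (hA : A.IsHermitian) {M : ℝ} (hM : ∀ i, hA.eigenvalues i ≤ M) (v : m → ℂ) :
    (star v ⬝ᵥ A.mulVec v).re ≤ M * (star v ⬝ᵥ v).re := by
  have hle : A ≤ algebraMap ℝ (Matrix m m ℂ) M := by
    refine le_algebraMap_of_spectrum_le (ha := hA.isSelfAdjoint) ?_
    rw [hA.spectrum_real_eq_range_eigenvalues]
    rintro _ ⟨i, rfl⟩
    exact hM i
  have hnonneg := (Matrix.le_iff.1 hle).re_dotProduct_nonneg v
  rw [Algebra.algebraMap_eq_smul_one, Matrix.sub_mulVec, Matrix.smul_mulVec, Matrix.one_mulVec,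
    dotProduct_sub, dotProduct_smul] at hnonneg
  simpa using hnonneg

lemma PSDBounded.psdLE {M : ℝ} (hM : PSDBounded μ x M) : PSDLE μ x M := fun θ hθ =>
  have ⟨hΦ, hle⟩ := hM.2 θ hθ
  re_dotProduct_mulVec_le_of_eigenvalues_le hΦ fun i => (hle i).2

end Eigenvalues

namespace IsStationaryGaussian

lemma memLp (hx : IsStationaryGaussian μ x) (i : Fin p) (k : ℤ) : MemLp (x i k) 2 μ :=
  (hx.gaussian.hasGaussianLaw_eval (i, k)).memLp_two

lemma covariance_eq (hx : IsStationaryGaussian μ x) (i j : Fin p) (k m : ℤ) :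
    cov[x i k, x j m; μ] = autocorr μ x (k - m) i j := by
  have := hx.gaussian.isProbabilityMeasure
  rw [covariance_eq_sub (hx.memLp i k) (hx.memLp j m), hx.mean_zero, hx.mean_zero, mul_zero,
    sub_zero, ← hx.stationary]
  rfl

lemma hasGaussianLaw_pi {T : Type*} [Finite T] (hx : IsStationaryGaussian μ x)
    (τ : T → Fin p × ℤ) : HasGaussianLaw (fun w t => x (τ t).1 (τ t).2 w) μ :=
  have := Fintype.ofFinite T
  ((hx.gaussian.comp_right τ).hasGaussianLaw Finset.univ).map_fun
    (LinearMap.toContinuousLinearMap <| LinearMap.funLeft ℝ ℝ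
      fun t => (⟨t, Finset.mem_univ t⟩ : (Finset.univ : Finset T)))

lemma isCentredGaussianLE {T : Type*} [Fintype T] (hx : IsStationaryGaussian μ x) {M : ℝ}
    (hM : PSDLE μ x M) {τ : T → Fin p × ℤ} (hτ : Function.Injective τ) :
    IsCentredGaussianLE (E := EuclideanSpace ℝ T)
      (fun w => WithLp.toLp 2 fun t => x (τ t).1 (τ t).2 w) M μ := by
  have := hx.gaussian.isProbabilityMeasure
  have hlaw : HasGaussianLaw (fun w => WithLp.toLp 2 fun t => x (τ t).1 (τ t).2 w) μ :=
    (hx.hasGaussianLaw_pi τ).toLp_pi 2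
  refine ⟨hlaw, ?_, fun u => ?_⟩
  · ext t
    exact (((EuclideanSpace.proj t : EuclideanSpace ℝ T →L[ℝ] ℝ).integral_comp_comm
      hlaw.integrable).symm.trans (hx.mean_zero _ _))
  · calc Var[fun w => inner ℝ u (WithLp.toLp 2 fun t => x (τ t).1 (τ t).2 w); μ]
        = Var[fun w => ∑ t, u t * x (τ t).1 (τ t).2 w; μ] := by
          simp only [PiLp.inner_apply, RCLike.inner_apply', conj_trivial]
      _ = ∑ s, ∑ t, u s * u t * autocorr μ x ((τ s).2 - (τ t).2) (τ s).1 (τ t).1 := by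
          rw [variance_fun_sum fun t => (hx.memLp _ _).const_mul _]
          simp_rw [covariance_const_mul_left, covariance_const_mul_right, hx.covariance_eq,
            mul_assoc]
      _ ≤ M * ∑ t, u t ^ 2 := sum_mul_mul_le_of_symbol_le hx.summable hM hτ u
      _ = M * ‖u‖ ^ 2 := by rw [EuclideanSpace.real_norm_sq_eq]

end IsStationaryGaussian

end StationaryGaussian

section Sampling

variable {Ω Ω' : Type*} [MeasurableSpace Ω] [MeasurableSpace Ω'] {μ : Measure Ω} {P : Measure Ω'}
  {p n N : ℕ} {x : Fin p → ℤ → Ω → ℝ}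

lemma outer_dft_apply (y : Fin N → Fin p → ℝ) (θ : ℝ) (i j : Fin p) :
    outer (dft y θ) i j = (1 / N : ℂ) * ∑ k : Fin N, ∑ l : Fin N,
      ((y k i * y l j : ℝ) : ℂ) * Complex.exp (-(Complex.I * θ * ((k : ℕ) - (l : ℕ)))) := by
  have hsqrt : (1 / N : ℂ) = ((1 / √N : ℝ) : ℂ) * (1 / √N : ℝ) := by
    rw [← Complex.ofReal_mul, div_mul_div_comm, Real.mul_self_sqrt N.cast_nonneg]
    simp
  have hconj : ∀ l : ℕ, (starRingEnd ℂ) (Complex.exp (-(Complex.I * θ * l)))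
      = Complex.exp (Complex.I * θ * l) := fun l => by simp [← Complex.exp_conj]
  simp only [outer, Matrix.vecMulVec_apply, Pi.star_apply, dft, star_mul', star_sum,
    Complex.star_def, Complex.conj_ofReal, hconj]
  rw [mul_mul_mul_comm, ← hsqrt, Finset.sum_mul_sum]
  congr! 3 with k _ l _
  rw [mul_sub, neg_sub', sub_neg_eq_add, Complex.exp_add]
  push_cast
  ring

lemma dftCov_apply {y : Ω → Fin N → Fin p → ℝ} (hy : ∀ k i, MemLp (fun w => y w k i) 2 μ)
    (θ : ℝ) (i j : Fin p) :
    dftCov μ y θ i j = (1 / N : ℂ) * ∑ k : Fin N, ∑ l : Fin N,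
      ((∫ w, y w k i * y w l j ∂μ : ℝ) : ℂ) *
        Complex.exp (-(Complex.I * θ * ((k : ℕ) - (l : ℕ)))) := by
  have hI : ∀ k l, Integrable (fun w => ((y w k i * y w l j : ℝ) : ℂ) *
      Complex.exp (-(Complex.I * θ * ((k : ℕ) - (l : ℕ))))) μ :=
    fun k l => ((hy k i).integrable_mul (hy l j)).ofReal.mul_const _
  simp only [dftCov, Matrix.of_apply, outer_dft_apply]
  rw [integral_const_mul, integral_finsetSum _ fun k _ => integrable_finsetSum _ fun l _ => hI k l]
  simp_rw [integral_finsetSum _ fun l _ => hI _ l, integral_mul_const, integral_complex_ofReal]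

lemma dftCov_eq_of_identDistrib {y : Ω → Fin N → Fin p → ℝ} {y' : Ω' → Fin N → Fin p → ℝ}
    (h : IdentDistrib y' y P μ) (θ : ℝ) : dftCov P y' θ = dftCov μ y θ := by
  ext i j
  refine (h.comp (u := fun z => outer (dft z θ) i j) ?_).integral_eq
  simp only [outer_dft_apply]
  fun_prop

lemma meanSpectrogram_eq_dftCov {y : Fin n → Ω → Fin N → Fin p → ℝ} {θ : ℝ}
    (h : ∀ r s, dftCov μ (y r) θ = dftCov μ (y s) θ) (s : Fin n) :
    meanSpectrogram μ y θ = dftCov μ (y s) θ := by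
  have hn : (n : ℂ) ≠ 0 := Nat.cast_ne_zero.2 (Fin.pos s).ne'
  rw [meanSpectrogram, Finset.sum_congr rfl fun r _ => h r s, Finset.sum_const, Finset.card_univ,
    Fintype.card_fin, ← Nat.cast_smul_eq_nsmul ℂ, smul_smul, one_div_mul_cancel hn, one_smul]

namespace IsStationaryGaussian

lemma dftCov_window (hx : IsStationaryGaussian μ x) (N : ℕ) (θ : ℝ) (t t' : ℤ) :
    dftCov μ (window x N t) θ = dftCov μ (window x N t') θ := by
  have hmem : ∀ t (k : Fin N) i, MemLp (fun w => window x N t w k i) 2 μ :=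
    fun t k i => hx.memLp i _
  ext i j
  rw [dftCov_apply (hmem t), dftCov_apply (hmem t')]
  simp only [window, hx.stationary, add_sub_add_left_eq_sub]

variable {M : ℝ}

lemma isCentredGaussianLE_window (hx : IsStationaryGaussian μ x) (hM : PSDLE μ x M) (N : ℕ)
    (t : ℤ) : IsCentredGaussianLE (fun w => flatten (window x N t w)) M μ :=
  hx.isCentredGaussianLE hM (τ := fun a : Fin N × Fin p => (a.2, t + (a.1 : ℕ))) fun a b h => by
    ext <;> simp_all

lemma isCentredGaussianLE_segments (hx : IsStationaryGaussian μ x) (hM₀ : 0 ≤ M)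
    (hM : PSDLE μ x M) (n N : ℕ) :
    IsCentredGaussianLE (E := PiLp 2 fun _ : Fin n => EuclideanSpace ℝ (Fin N × Fin p))
      (fun w => WithLp.toLp 2 fun r => flatten (segments n N x r w)) M μ := by
  have hτ : Function.Injective fun a : (_ : Fin n) × (Fin N × Fin p) =>
      (a.2.2, (((a.1 : ℕ) * N : ℕ) : ℤ) + (a.2.1 : ℕ)) := by
    rintro ⟨r, k, i⟩ ⟨r', k', i'⟩ h
    obtain ⟨rfl, h⟩ := Prod.mk.inj h
    have hrk : finProdFinEquiv (r, k) = finProdFinEquiv (r', k') := by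
      ext
      simp only [finProdFinEquiv_apply_val, mul_comm N]
      grind
    obtain ⟨rfl, rfl⟩ := Prod.mk.inj (finProdFinEquiv.injective hrk)
    rfl
  exact (hx.isCentredGaussianLE hM hτ).map hM₀
    (LinearIsometryEquiv.piLpCurry ℝ 2
      fun (_ : Fin n) (_ : Fin N × Fin p) => ℝ).toLinearIsometry.norm_toContinuousLinearMap_le

lemma isCentredGaussianLE_restartRecord (hx : IsStationaryGaussian μ x) (hM : PSDLE μ x M)
    {y : Fin n → Ω' → Fin N → Fin p → ℝ} (hy : IsRestartRecord μ x P y) :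
    IsCentredGaussianLE (E := PiLp 2 fun _ : Fin n => EuclideanSpace ℝ (Fin N × Fin p))
      (fun w => WithLp.toLp 2 fun r => flatten (y r w)) M P := by
  have hflatten : Measurable (flatten : (Fin N → Fin p → ℝ) → _) := by
    unfold flatten
    fun_prop
  exact .of_iIndepFun (hy.1.comp (fun _ => flatten) fun _ => hflatten) fun r =>
    (hx.isCentredGaussianLE_window hM N 0).of_identDistrib ((hy.2 r).comp hflatten)

end IsStationaryGaussian

end Sampling

section JointStationarity

variable {H : Type*} [NormedAddCommGroup H] [InnerProductSpace ℝ H]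

/-- Two sequences in a Hilbert space are jointly stationary with summable cross-correlation. -/
structure JointlyStationary (X Y : ℤ → H) : Prop where
  inner_add : ∀ k m, inner ℝ (X (k + m)) (Y m) = inner ℝ (X k) (Y 0)
  summable : Summable fun k => inner ℝ (X k) (Y 0)

/-- The convolution `g ⋆ X` of a scalar filter with a vector valued sequence. It is meaningful when
`g` is summable and `X` is bounded. -/
def convolve (g : ℤ → ℝ) (X : ℤ → H) (k : ℤ) : H :=
  ∑' l, g l • X (k - l)

lemma norm_smul_sub_le {X : ℤ → H} {C : ℝ} (hX : ∀ k, ‖X k‖ ≤ C) (g : ℤ → ℝ) (k l : ℤ) :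
    ‖g l • X (k - l)‖ ≤ |g l| * C := by
  rw [norm_smul, Real.norm_eq_abs]
  gcongr
  exact hX _

lemma summable_norm_smul_sub {g : ℤ → ℝ} (hg : Summable g) {X : ℤ → H} {C : ℝ}
    (hX : ∀ k, ‖X k‖ ≤ C) (k : ℤ) : Summable fun l => ‖g l • X (k - l)‖ :=
  .of_nonneg_of_le (fun _ => norm_nonneg _) (norm_smul_sub_le hX g k) (hg.abs.mul_right C)

lemma norm_convolve_le {g : ℤ → ℝ} (hg : Summable g) {X : ℤ → H} {C : ℝ}
    (hX : ∀ k, ‖X k‖ ≤ C) (k : ℤ) : ‖convolve g X k‖ ≤ (∑' l, |g l|) * C := by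
  rw [← tsum_mul_right]
  exact tsum_of_norm_bounded (hg.abs.mul_right C).hasSum (norm_smul_sub_le hX g k)

namespace JointlyStationary

variable {X Y Z : ℤ → H}

lemma symm (h : JointlyStationary X Y) : JointlyStationary Y X := by
  have hneg : ∀ k m, inner ℝ (Y (k + m)) (X m) = inner ℝ (X (-k)) (Y 0) := fun k m => by
    rw [real_inner_comm, ← h.inner_add (-k) (k + m), neg_add_cancel_left]
  have hneg₀ : ∀ k, inner ℝ (Y k) (X 0) = inner ℝ (X (-k)) (Y 0) := fun k => by
    simpa using hneg k 0
  refine ⟨fun k m => by rw [hneg, hneg₀], ?_⟩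
  simp_rw [hneg₀]
  exact (Equiv.neg ℤ).summable_iff.2 h.summable

lemma norm_eq (h : JointlyStationary X X) (k : ℤ) : ‖X k‖ = ‖X 0‖ := by
  rw [norm_eq_sqrt_real_inner, norm_eq_sqrt_real_inner (X 0)]
  simpa using congrArg Real.sqrt (h.inner_add 0 k)

lemma zero_left (Z : ℤ → H) : JointlyStationary 0 Z :=
  ⟨by simp, by simp [summable_zero]⟩

lemma add (hX : JointlyStationary X Z) (hY : JointlyStationary Y Z) :
    JointlyStationary (X + Y) Z where
  inner_add k m := by simp only [Pi.add_apply, inner_add_left, hX.inner_add, hY.inner_add]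
  summable := by
    simpa only [Pi.add_apply, inner_add_left] using hX.summable.add hY.summable

variable [CompleteSpace H]

lemma convolve (hX : JointlyStationary X Z) {g : ℤ → ℝ} (hg : Summable g) {C : ℝ}
    (hC : ∀ k, ‖X k‖ ≤ C) : JointlyStationary (convolve g X) Z := by
  have inner_convolve : ∀ k z,
      inner ℝ (DDAG.convolve g X k) z = ∑' l, g l * inner ℝ (X (k - l)) z := fun k z => by
    simp_rw [← real_inner_smul_left, real_inner_comm z]
    exact (innerSL ℝ z).map_tsum (summable_norm_smul_sub hg hC k).of_norm
  constructor
  · intro k m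
    simp_rw [inner_convolve, add_sub_right_comm, hX.inner_add]
  · simp_rw [inner_convolve]
    have hprod : Summable fun a : ℤ × ℤ => g a.1 * inner ℝ (X a.2) (Z 0) :=
      summable_mul_of_summable_norm hg.norm hX.summable.norm
    have hinj : Function.Injective fun a : ℤ × ℤ => (a.2, a.1 - a.2) := by
      rintro ⟨a, b⟩ ⟨c, d⟩ h
      simp only [Prod.mk.injEq] at h ⊢
      omega
    exact (hprod.comp_injective hinj).prod

end JointlyStationary

/-- The sequences obtained from the inputs `E i` by finitely many additions and convolutions with
summable filters. -/
inductive FilterOutput {ι : Type*} (E : ι → ℤ → H) : (ℤ → H) → Prop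
  | input (i : ι) : FilterOutput E (E i)
  | zero : FilterOutput E 0
  | add {X Y : ℤ → H} : FilterOutput E X → FilterOutput E Y → FilterOutput E (X + Y)
  | convolve {g : ℤ → ℝ} {X : ℤ → H} :
      Summable g → FilterOutput E X → FilterOutput E (convolve g X)

namespace FilterOutput

variable {ι : Type*} {E : ι → ℤ → H} {X Y Z : ℤ → H}

lemma sum {κ : Type*} (s : Finset κ) {X : κ → ℤ → H} (hX : ∀ j ∈ s, FilterOutput E (X j)) :
    FilterOutput E (∑ j ∈ s, X j) :=
  Finset.sum_induction X (FilterOutput E) (fun _ _ => .add) .zero hX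

lemma exists_norm_le (hX : FilterOutput E X) (hE : ∀ i, JointlyStationary (E i) (E i)) :
    ∃ C, ∀ k, ‖X k‖ ≤ C := by
  induction hX with
  | input i => exact ⟨‖E i 0‖, fun k => ((hE i).norm_eq k).le⟩
  | zero => exact ⟨0, fun _ => norm_zero.le⟩
  | add _ _ ihX ihY =>
    obtain ⟨⟨C, hC⟩, ⟨D, hD⟩⟩ := ihX, ihY
    exact ⟨C + D, fun k => norm_add_le_of_le (hC k) (hD k)⟩
  | convolve hg _ ih => exact ih.imp' _ fun _ hC => norm_convolve_le hg hC

lemma mem_closure_span (hX : FilterOutput E X) (k : ℤ) :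
    X k ∈ (Submodule.span ℝ (Set.range fun t : ι × ℤ => E t.1 t.2)).topologicalClosure := by
  induction hX generalizing k with
  | input i => exact Submodule.le_topologicalClosure _ (Submodule.subset_span ⟨(i, k), rfl⟩)
  | zero => exact zero_mem _
  | add _ _ ihX ihY => exact add_mem (ihX k) (ihY k)
  | convolve _ _ ih =>
    exact tsum_mem (Submodule.isClosed_topologicalClosure _)
      fun l => Submodule.smul_mem _ _ (ih (k - l))

variable [CompleteSpace H]

lemma jointlyStationary_of_inputs (hX : FilterOutput E X)
    (hE : ∀ i, JointlyStationary (E i) (E i)) (hZ : ∀ i, JointlyStationary (E i) Z) :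
    JointlyStationary X Z := by
  induction hX with
  | input i => exact hZ i
  | zero => exact .zero_left Z
  | add _ _ ihX ihY => exact ihX.add ihY
  | convolve hg hX ih =>
    obtain ⟨C, hC⟩ := hX.exists_norm_le hE
    exact ih.convolve hg hC

lemma jointlyStationary (hX : FilterOutput E X) (hY : FilterOutput E Y)
    (hE : ∀ i j, JointlyStationary (E i) (E j)) : JointlyStationary X Y :=
  hX.jointlyStationary_of_inputs (fun i => hE i i) fun i =>
    (hY.jointlyStationary_of_inputs (fun j => hE j j) fun j => hE j i).symm

end FilterOutput

end JointStationarity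

section GaussianSpace

variable {Ω : Type*} [MeasurableSpace Ω] {μ : Measure Ω}

open Filter Topology in
lemma tendsto_charFun_map_of_tendsto_Lp [IsProbabilityMeasure μ] {F : ℕ → Lp ℝ 2 μ} {f : Lp ℝ 2 μ}
    (hF : Tendsto F atTop (𝓝 f)) (t : ℝ) :
    Tendsto (fun n => charFun (μ.map (F n)) t) atTop (𝓝 (charFun (μ.map f) t)) :=
  ProbabilityMeasure.tendsto_iff_tendsto_charFun.1
    ((tendstoInMeasure_of_tendsto_Lp hF).tendstoInDistribution fun n =>
      (Lp.aestronglyMeasurable (F n)).aemeasurable).tendsto t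

lemma isClosed_setOf_map_eq_gaussianReal [IsProbabilityMeasure μ] :
    IsClosed {f : Lp ℝ 2 μ | μ.map f = gaussianReal 0 (‖f‖₊ ^ 2)} := by
  refine IsSeqClosed.isClosed fun F f hF hlim => ?_
  have := Measure.isProbabilityMeasure_map (Lp.aestronglyMeasurable f).aemeasurable
  refine Measure.ext_of_charFun (funext fun t => ?_)
  refine tendsto_nhds_unique (tendsto_charFun_map_of_tendsto_Lp hlim t) ?_
  simp only [Set.mem_ofPred_eq] at hF
  simp only [hF, charFun_gaussianReal, NNReal.coe_pow, coe_nnnorm]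
  exact ((by fun_prop : Continuous fun f : Lp ℝ 2 μ =>
    Complex.exp (t * (0 : ℝ) * Complex.I - (‖f‖ ^ 2 : ℝ) * t ^ 2 / 2)).tendsto f).comp hlim

lemma coeFn_sum_smul {T : Type*} (s : Finset T) (c : T → ℝ) (F : T → Lp ℝ 2 μ) :
    (∑ t ∈ s, c t • F t : Lp ℝ 2 μ) =ᵐ[μ] fun w => ∑ t ∈ s, c t • F t w := by
  have hsmul : ∀ᵐ w ∂μ, ∀ t ∈ s, (c t • F t : Lp ℝ 2 μ) w = c t • F t w :=
    (Filter.eventually_all_finset s).2 fun t _ => Lp.coeFn_smul (c t) (F t)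
  filter_upwards [Lp.coeFn_fun_finsetSum s fun t => c t • F t, hsmul] with w hsum hsmul
  rw [hsum, Finset.sum_congr rfl hsmul]

variable {S T : Type*} {E : T → Lp ℝ 2 μ}

lemma map_eq_gaussianReal_of_mem_span (hE : IsGaussianProcess (fun t => ⇑(E t)) μ)
    (hE₀ : ∀ t, ∫ w, E t w ∂μ = 0) {f : Lp ℝ 2 μ} (hf : f ∈ Submodule.span ℝ (Set.range E)) :
    μ.map f = gaussianReal 0 (‖f‖₊ ^ 2) := by
  obtain ⟨c, rfl⟩ := Finsupp.mem_span_range_iff_exists_finsupp.1 hf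
  set f := c.sum fun t a => a • E t
  have hae : f =ᵐ[μ] fun w => ∑ t ∈ c.support, c t • E t w := coeFn_sum_smul c.support c E
  have hlaw : HasGaussianLaw f μ := (hE.smul c).hasGaussianLaw_fun_sum.congr hae.symm
  have hmean : ∫ w, f w ∂μ = 0 := by
    have hint : ∀ t ∈ c.support, Integrable (fun w => c t • E t w) μ := fun t _ =>
      (hE.hasGaussianLaw_eval t).integrable.smul (c t)
    rw [integral_congr_ae hae, integral_finsetSum _ hint]
    simp [integral_const_mul, hE₀]
  have hvar : Var[f; μ] = ‖f‖ ^ 2 := by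
    rw [variance_of_integral_eq_zero hlaw.aemeasurable hmean, ← real_inner_self_eq_norm_sq,
      L2.inner_def]
    simp [sq]
  rw [hlaw.map_eq_gaussianReal, hmean, hvar]
  congr 1
  ext
  simp

lemma map_eq_gaussianReal_of_mem_closure_span (hE : IsGaussianProcess (fun t => ⇑(E t)) μ)
    (hE₀ : ∀ t, ∫ w, E t w ∂μ = 0) {f : Lp ℝ 2 μ}
    (hf : f ∈ (Submodule.span ℝ (Set.range E)).topologicalClosure) :
    μ.map f = gaussianReal 0 (‖f‖₊ ^ 2) :=
  have := hE.isProbabilityMeasure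
  closure_minimal (fun _ => map_eq_gaussianReal_of_mem_span hE hE₀)
    isClosed_setOf_map_eq_gaussianReal hf

lemma isGaussianProcess_of_mem_closure_span (hE : IsGaussianProcess (fun t => ⇑(E t)) μ)
    (hE₀ : ∀ t, ∫ w, E t w ∂μ = 0) {F : S → Lp ℝ 2 μ}
    (hF : ∀ s, F s ∈ (Submodule.span ℝ (Set.range E)).topologicalClosure) :
    IsGaussianProcess (fun s => ⇑(F s)) μ where
  hasGaussianLaw I := by
    classical
    have hmeas : AEMeasurable (fun w => I.restrict fun s => F s w) μ :=
      aemeasurable_pi_lambda _ fun s => (Lp.aestronglyMeasurable (F s)).aemeasurable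
    refine ⟨isGaussian_of_isGaussian_map fun L => ?_⟩
    let c : I → ℝ := fun s => L fun j => if s = j then 1 else 0
    have hL : (fun w => L (I.restrict fun s => F s w))
        =ᵐ[μ] (∑ s, c s • F s : Lp ℝ 2 μ) := by
      refine .trans (.of_forall fun w => ?_) (coeFn_sum_smul Finset.univ c fun s => F s).symm
      exact (L.toLinearMap.pi_apply_eq_sum_univ _).trans
        (Finset.sum_congr rfl fun s _ => mul_comm _ _)
    have hmem : ∑ s, c s • F s ∈ (Submodule.span ℝ (Set.range E)).topologicalClosure :=
      sum_mem fun s _ => Submodule.smul_mem _ _ (hF s)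
    rw [AEMeasurable.map_map_of_aemeasurable (by fun_prop) hmeas, Function.comp_def,
      Measure.map_congr hL, map_eq_gaussianReal_of_mem_closure_span hE hE₀ hmem]
    infer_instance

lemma integral_eq_zero_of_mem_closure_span (hE : IsGaussianProcess (fun t => ⇑(E t)) μ)
    (hE₀ : ∀ t, ∫ w, E t w ∂μ = 0) {f : Lp ℝ 2 μ}
    (hf : f ∈ (Submodule.span ℝ (Set.range E)).topologicalClosure) : ∫ w, f w ∂μ = 0 := by
  rw [← integral_map (f := fun z : ℝ => z) (Lp.aestronglyMeasurable f).aemeasurable (by fun_prop),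
    map_eq_gaussianReal_of_mem_closure_span hE hE₀ hf, integral_id_gaussianReal]

end GaussianSpace

section StateProcess

variable {Ω : Type*} [MeasurableSpace Ω] {μ : Measure Ω}

lemma coeFn_convolve {z : ℤ → Ω → ℝ} {Z : ℤ → Lp ℝ 2 μ} (hZ : ∀ k, Z k =ᵐ[μ] z k) {C : ℝ}
    (hC : ∀ k, ‖Z k‖ ≤ C) {g : ℤ → ℝ} (hg : Summable g) (k : ℤ) :
    (convolve g Z k : Lp ℝ 2 μ) =ᵐ[μ] fun w => ∑' l, g l * z (k - l) w := by
  have hsum : ∑' l, ‖g l • Z (k - l)‖ₑ ≠ ⊤ := by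
    simp_rw [← ofReal_norm]
    exact (summable_norm_smul_sub hg hC k).tsum_ofReal_ne_top
  have hterm : ∀ᵐ w ∂μ, ∀ l, (g l • Z (k - l) : Lp ℝ 2 μ) w = g l * z (k - l) w := by
    refine ae_all_iff.2 fun l => ?_
    filter_upwards [Lp.coeFn_smul (g l) (Z (k - l)), hZ (k - l)] with w hsmul hZw
    rw [hsmul, Pi.smul_apply, hZw, smul_eq_mul]
  filter_upwards [Lp.coeFn_tsum hsum, hterm] with w hw hterm
  exact hw.trans (tsum_congr hterm)

lemma inner_eq_integral_mul {F F' : Lp ℝ 2 μ} {f f' : Ω → ℝ} (hF : F =ᵐ[μ] f)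
    (hF' : F' =ᵐ[μ] f') : inner ℝ F F' = ∫ w, f w * f' w ∂μ := by
  rw [L2.inner_def]
  refine integral_congr_ae ?_
  filter_upwards [hF, hF'] with w h h'
  simp [h, h', mul_comm]

lemma IsAcyclic.induction {V : Type*} [Finite V] {G : Digraph V} (hG : IsAcyclic G) {Q : V → Prop}
    (hQ : ∀ i, (∀ j, G.Adj j i → Q j) → Q i) (i : V) : Q i :=
  have : Std.Irrefl (Relation.TransGen G.Adj) := ⟨hG⟩
  (Finite.wellFounded_of_trans_of_irrefl (Relation.TransGen G.Adj)).induction i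
    fun i ih => hQ i fun j hj => ih j (.single hj)

variable {p : ℕ} {G : Digraph (Fin p)} {h : Fin p → Fin p → ℤ → ℝ} {σ : ℝ → ℝ}
  {e x : Fin p → ℤ → Ω → ℝ} {E : Fin p → ℤ → Lp ℝ 2 μ}

lemma IsNoise.jointlyStationary (he : IsNoise μ e σ) (hE : ∀ i k, E i k =ᵐ[μ] e i k)
    (i j : Fin p) : JointlyStationary (E i) (E j) := by
  have hinner : ∀ k m, inner ℝ (E i k) (E j m) = ∫ w, e i k w * e j m w ∂μ := fun k m =>
    inner_eq_integral_mul (hE i k) (hE j m)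
  rcases eq_or_ne i j with rfl | hij
  · exact ⟨by simpa only [hinner] using he.stationary i,
      by simpa only [hinner, autocorr, Matrix.of_apply] using he.summable i⟩
  · simp only [he.uncorrelated i j hij] at hinner
    exact ⟨by simp [hinner], by simp [hinner, summable_zero]⟩

namespace IsLDS

lemma exists_filterOutput (hx : IsLDS μ G h σ e x) (hE : ∀ i k, E i k =ᵐ[μ] e i k) (i : Fin p) :
    ∃ X, FilterOutput E X ∧ ∀ k, X k =ᵐ[μ] x i k := by
  classical
  refine hx.acyclic.induction (Q := fun i => ∃ X, FilterOutput E X ∧ ∀ k, X k =ᵐ[μ] x i k)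
    (fun i ih => ?_) i
  choose! X hX hXx using ih
  refine ⟨∑ j with G.Adj j i, convolve (h i j) (X j) + E i, .add (.sum _ fun j hj => ?_) (.input i),
    fun k => ?_⟩
  · have hji := (Finset.mem_filter.1 hj).2
    exact .convolve (hx.filter_summable i j hji) (hX j hji)
  have hconv : ∀ᵐ w ∂μ, ∀ j ∈ Finset.univ.filter (G.Adj · i),
      convolve (h i j) (X j) k w = ∑' l, h i j l * x j (k - l) w := by
    refine (Filter.eventually_all_finset _).2 fun j hj => ?_
    have hji := (Finset.mem_filter.1 hj).2
    obtain ⟨C, hC⟩ := (hX j hji).exists_norm_le fun i => hx.noise.jointlyStationary hE i i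
    exact coeFn_convolve (hXx j hji) hC (hx.filter_summable i j hji) k
  rw [Pi.add_apply, Finset.sum_apply]
  filter_upwards [Lp.coeFn_add (∑ j with G.Adj j i, convolve (h i j) (X j) k) (E i k),
    Lp.coeFn_fun_finsetSum {j | G.Adj j i} fun j => convolve (h i j) (X j) k, hconv, hE i k,
    hx.evolution i k] with w hadd hsum hconv hEw hev
  rw [hadd, Pi.add_apply, hsum, Finset.sum_congr rfl hconv, hEw, hev]

theorem isStationaryGaussian (hx : IsLDS μ G h σ e x) : IsStationaryGaussian μ x := by
  have hmem : ∀ i k, MemLp (e i k) 2 μ := fun i k =>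
    (hx.noise.gaussian.hasGaussianLaw_eval (i, k)).memLp_two
  let E : Fin p → ℤ → Lp ℝ 2 μ := fun i k => (hmem i k).toLp
  have hE : ∀ i k, E i k =ᵐ[μ] e i k := fun i k => (hmem i k).coeFn_toLp
  have hgauss : IsGaussianProcess (fun t : Fin p × ℤ => ⇑(E t.1 t.2)) μ :=
    hx.noise.gaussian.congr fun t => (hE t.1 t.2).symm
  have hmean : ∀ t : Fin p × ℤ, ∫ w, E t.1 t.2 w ∂μ = 0 := fun t =>
    (integral_congr_ae (hE t.1 t.2)).trans (hx.noise.mean_zero t.1 t.2)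
  choose X hX hXx using hx.exists_filterOutput hE
  have hjoint : ∀ i j, JointlyStationary (X i) (X j) := fun i j =>
    (hX i).jointlyStationary (hX j) (hx.noise.jointlyStationary hE)
  have hinner : ∀ i j k m, inner ℝ (X i k) (X j m) = ∫ w, x i k w * x j m w ∂μ :=
    fun i j k m => inner_eq_integral_mul (hXx i k) (hXx j m)
  exact {
    gaussian := (isGaussianProcess_of_mem_closure_span hgauss hmean fun t : Fin p × ℤ =>
      (hX t.1).mem_closure_span t.2).congr fun t => hXx t.1 t.2
    mean_zero := fun i k => (integral_congr_ae (hXx i k)).symm.trans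
      (integral_eq_zero_of_mem_closure_span hgauss hmean ((hX i).mem_closure_span k))
    stationary := fun i j k m => by
      simpa only [hinner, sub_add_cancel, autocorr, Matrix.of_apply]
        using (hjoint i j).inner_add (k - m) m
    summable := fun i j => by
      simpa only [hinner, autocorr, Matrix.of_apply] using (hjoint i j).summable }

end IsLDS

end StateProcess

end DDAG

end

theorem theorem4p2_general {Ω Ω' : Type*} [MeasurableSpace Ω] [MeasurableSpace Ω']
    {μ : Measure Ω} {P : Measure Ω'} {p n N : ℕ} (hN : 0 < N) {x : Fin p → ℤ → Ω → ℝ}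
    (hx : DDAG.IsStationaryGaussian μ x) {M : ℝ} (hM : 0 < M) (hΦ : DDAG.PSDLE μ x M)
    (θ : ℝ) {ε : ℝ} (hε : 0 ≤ ε) (hεM : ε ≤ 12 * M) :
    (∀ y : Fin n → Ω' → Fin N → Fin p → ℝ, DDAG.IsRestartRecord μ x P y → ∀ s : Fin n,
      P.real {w | ε ≤ ‖DDAG.spectrogram (fun r => y r w) θ - DDAG.dftCov P (y s) θ‖}
        ≤ Real.exp (-(ε ^ 2 * n / (128 * M ^ 2)) + 6 * p)) ∧
    (∀ s : Fin n,
      μ.real {w | ε ≤ ‖DDAG.spectrogram (fun r => DDAG.segments n N x r w) θ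
          - DDAG.dftCov μ (DDAG.segments n N x s) θ‖}
        ≤ Real.exp (-(ε ^ 2 * n / (128 * M ^ 2)) + 6 * p)) := by
  constructor
  · intro y hy s
    have hcov : ∀ r s, DDAG.dftCov P (y r) θ = DDAG.dftCov P (y s) θ := fun r s =>
      (DDAG.dftCov_eq_of_identDistrib (hy.2 r) θ).trans
        (DDAG.dftCov_eq_of_identDistrib (hy.2 s) θ).symm
    rw [← DDAG.meanSpectrogram_eq_dftCov hcov s]
    exact DDAG.measureReal_spectrogram_sub_meanSpectrogram_ge_le (Fin.pos s) hN hM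
      (hx.isCentredGaussianLE_restartRecord hΦ hy) θ hε hεM
  · intro s
    have hcov : ∀ r s, DDAG.dftCov μ (DDAG.segments n N x r) θ
        = DDAG.dftCov μ (DDAG.segments n N x s) θ := fun r s => hx.dftCov_window N θ _ _
    rw [← DDAG.meanSpectrogram_eq_dftCov hcov s]
    exact DDAG.measureReal_spectrogram_sub_meanSpectrogram_ge_le (Fin.pos s) hN hM
      (hx.isCentredGaussianLE_segments hM.le hΦ n N) θ hε hεM

theorem theorem4p2 {Ω Ω' : Type*} [MeasurableSpace Ω] [MeasurableSpace Ω']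
    (μ : Measure Ω) [IsProbabilityMeasure μ] (P : Measure Ω') [IsProbabilityMeasure P]
    {p n N : ℕ} (hn : 0 < n) (hN : 0 < N)
    (G : Digraph (Fin p)) (h : Fin p → Fin p → ℤ → ℝ) (σ : ℝ → ℝ)
    (e x : Fin p → ℤ → Ω → ℝ) (hx : DDAG.IsLDS μ G h σ e x)
    (M : ℝ) (hM : DDAG.PSDBounded μ x M)
    (θ : ℝ) (hθ : θ ∈ Set.Icc 0 (2 * Real.pi))
    (ε : ℝ) (hε : 0 ≤ ε) (hεM : ε ≤ 12 * M) :
    -- restart and record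
    (∀ y : Fin n → Ω' → Fin N → Fin p → ℝ, DDAG.IsRestartRecord μ x P y → ∀ s : Fin n,
      P.real {w | ε ≤ ‖DDAG.spectrogram (fun r => y r w) θ - DDAG.dftCov P (y s) θ‖}
        ≤ Real.exp (-(ε ^ 2 * n / (128 * M ^ 2)) + 6 * p)) ∧
    -- continuous sampling
    (∀ s : Fin n,
      μ.real {w | ε ≤ ‖DDAG.spectrogram (fun r => DDAG.segments n N x r w) θ
          - DDAG.dftCov μ (DDAG.segments n N x s) θ‖}
        ≤ Real.exp (-(ε ^ 2 * n / (128 * M ^ 2)) + 6 * p)) := by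
  exact theorem4p2_general hN hx.isStationaryGaussian hM.1 hM.psdLE θ hε hεM
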